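/- Let $\mathbb{T}=\mathbb{R}/\mathbb{Z}$ be the circle with its normalized Lebesgue measure $\mathrm{Vol}$ and the distance $\rho(x,y)=\min_{n\in\mathbb{Z}}|x-y-n|$. For $T\in\mathbb{N}$ (including $T=0$) let the harmonic ensemble $X=X(T,\mathbb{T})$ be the determinantal point process on $\mathbb{T}$ with kernel $K(x,y)=\sum_{|k|\le T}e^{2\pi i k(x-y)}$, that is, the simple point process whose joint intensities with respect to $\mathrm{Vol}$ are $\det(K(x_i,x_j))_{i,j=1}^k$, $k\ge 1$. For a finite set $A=\{a_1,\dots,a_N\}\subset\mathbb{T}$ with $N\geq 1$ elements let $$D_{\mathrm{per},2}(A)=\left(\int_{\mathbb{T}}\int_{\mathbb{T}}\left|\frac{|A\cap[x,y]_{\mathrm{per}}|}{N}-\mathrm{Vol}([x,y]_{\mathrm{per}})\right|^2 d\mathrm{Vol}(x)\,d\mathrm{Vol}(y)\right)^{1/2},$$ where $[x,y]_{\mathrm{per}}$ is the closed arc from $x$ to $y$ in counterclockwise direction, and let $$W_2(A,\mathrm{Vol})=\inf_{\pi}\left(\int_{\mathbb{T}\times\mathbb{T}}\rho(x,y)^2\,d\pi(x,y)\right)^{1/2},$$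 where $\pi$ runs through the couplings of the empirical measure $\frac1N\sum_{n=1}^N\delta_{a_n}$ and $\mathrm{Vol}$. Then almost surely $X$ has exactly $N=2T+1$ points, and $$\mathbb{E}\,W_2^2(X,\mathrm{Vol})=\frac12\,\mathbb{E}\,D_{\mathrm{per},2}^2(X)=\frac{1}{2\pi^2N^2}\sum_{k=1}^N\frac1k+\frac{1}{2\pi^2N}\sum_{k=N+1}^\infty\frac1{k^2}=\frac{\log N+\gamma+1}{2\pi^2N^2}+O\left(\frac1{N^3}\right)$$ with an absolute implied constant, where $\gamma$ is Euler's constant. In particular, $$\sqrt{\mathbb{E}\,W_2^2(X,\mathrm{Vol})}=\frac1{\sqrt2}\sqrt{\mathbb{E}\,D_{\mathrm{per},2}^2(X)}\sim\frac{\sqrt{\log N}}{\sqrt2\,\pi N}\qquad(T\to\infty).$$ -/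

import Mathlib

open MeasureTheory Filter Topology
open scoped ENNReal

/-- `π` is a coupling (transport plan) of `μ` and `ν`: its marginals are `μ` and `ν`. -/
def IsCoupling {M : Type*} [MeasurableSpace M] (π : Measure (M × M)) (μ ν : Measure M) : Prop :=
  π.map Prod.fst = μ ∧ π.map Prod.snd = ν

/-- The `p`-Wasserstein distance
`inf_π (∫ dist(x, y) ^ p dπ(x, y)) ^ (1 / p)`, the infimum being over all couplings of `μ`, `ν`. -/
noncomputable def wassersteinDist {M : Type*} [MeasurableSpace M] [PseudoMetricSpace M]
    (p : ℝ) (μ ν : Measure M) : ℝ :=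
  (⨅ (π : Measure (M × M)) (_ : IsCoupling π μ ν),
    (∫⁻ z, edist z.1 z.2 ^ p ∂π) ^ (1 / p)).toReal

/-- The empirical measure `(1 / N) ∑ δ_a` of a finite set with `N` elements. -/
noncomputable def empiricalMeasure {M : Type*} [MeasurableSpace M] (A : Finset M) : Measure M :=
  (A.card : ℝ≥0∞)⁻¹ • ∑ a ∈ A, Measure.dirac a

/-- The periodic `L²` discrepancy of a finite subset of the circle `ℝ / ℤ`. Here `Set.cIcc x y` is
the closed arc that leads counterclockwise from `x` to `y`. -/
noncomputable def periodicDiscrepancy (A : Finset UnitAddCircle) : ℝ :=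
  Real.sqrt (∫ y : UnitAddCircle, ∫ x : UnitAddCircle,
    |(((A : Set UnitAddCircle) ∩ Set.cIcc x y).ncard : ℝ) / (A.card : ℝ)
      - (volume : Measure UnitAddCircle).real (Set.cIcc x y)| ^ 2)

/-- A random finite subset `X` of `M` (a simple point process with finitely many points), defined
on the probability space `(Ω, P)`, is a determinantal point process with kernel `K` with respect to
`ν` if its joint intensities are `det (K (x i) (x j))`: for every `k ≥ 1` and every measurable
`B ⊆ M ^ k`, the expected number of `k`-tuples of distinct points of `X` that lie in `B` is the
integral of that determinant over `B`. (For Hermitian positive semidefinite `K` the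
determinant is a nonnegative real number.) -/
structure IsDeterminantalProcess {M Ω : Type*} [MeasurableSpace M] [MeasurableSpace Ω]
    (K : M → M → ℂ) (ν : Measure M) [SigmaFinite ν] (P : Measure Ω) (X : Ω → Finset M) : Prop where
  measurable_count : ∀ B : Set M, MeasurableSet B →
    Measurable fun ω => ((X ω : Set M) ∩ B).ncard
  joint_intensity : ∀ k : ℕ, 1 ≤ k → ∀ B : Set (Fin k → M), MeasurableSet B →
    ∫⁻ ω, (({x : Fin k → M | Function.Injective x ∧ (∀ i, x i ∈ X ω) ∧ x ∈ B}.ncard : ℕ) : ℝ≥0∞) ∂P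
      = ∫⁻ x in B, ENNReal.ofReal (Matrix.of fun i j => K (x i) (x j)).det.re
          ∂(Measure.pi fun _ : Fin k => ν)

/-- The kernel `K(x, y) = ∑_{|k| ≤ T} exp(2πik(x - y))` on the circle `ℝ / ℤ`. -/
noncomputable def harmonicKernel (T : ℕ) (x y : UnitAddCircle) : ℂ :=
  ∑ k ∈ Finset.Icc (-(T : ℤ)) (T : ℤ), fourier (T := (1 : ℝ)) k (x - y)

/-- `X` is a harmonic ensemble on the circle `ℝ / ℤ`, of degree `T`. -/
def IsHarmonicEnsemble {Ω : Type*} [MeasurableSpace Ω] (T : ℕ) (P : Measure Ω)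
    (X : Ω → Finset UnitAddCircle) : Prop :=
  IsDeterminantalProcess (harmonicKernel T) (volume : Measure UnitAddCircle) P X

/-!
Both random quantities are, pointwise on samples with exactly `N` points, multiples of the same pair
energy `E(A) = ∑_{p, q ∈ A} B₂(p - q)`, where `B₂(t) = t² - t + 1/6` is the periodized Bernoulli
polynomial: `D_per² = E / N²` (`periodicDiscrepancy_sq`) and `W₂² = E / (2 N²)`
(`wassersteinDist_sq`).

For the discrepancy, `1[a ∈ [x, y]] - Vol [x, y]` is a difference of a function of `x` and the same
function of `y`, so `D_per²` is twice the variance of `x + |{a ∈ A : x < a}| / N` over `x ∈ [0, 1]`.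

For the Wasserstein distance, lift the points to a monotone sequence `α : ℤ → ℝ` with
`α (m + N) = α m + 1` and send the `m`-th cell `[θ + m / N, θ + (m + 1) / N)` to `α m`. This map `S`
is monotone; if `θ` is such that `t - S t` has mean zero over a period, then
`ψ z = 2 ∫_θ^z (t - S t) dt` is periodic and descends to the circle. Since `z² - ψ z` has the
monotone function `2 S` as its derivative it is convex, which makes `ψ` a Kantorovich potential:
every coupling costs at least as much as the one induced by `S`
(`cellCost_le_of_isCoupling`, `exists_isCoupling_le`). The cost of `S` is an explicit quadratic
expression in the points (`cellCost_eq`).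

For the harmonic ensemble, the first two joint intensities give
`𝔼 |X| = N` and `𝔼 |X|² = N²`, so `|X| = N` almost surely (`card_harmonicEnsemble`), and they
determine the second moment measure `B × C ↦ 𝔼 |X ∩ B| |X ∩ C|`, a sum of a measure with density
`N² - |K|²` and of `N` times the diagonal. Integrating `B₂(x - y)` against it leaves the Fourier
coefficients `1 / (2π²m²)` of `B₂` at the frequencies `m = l - j` of `|K|²`
(`integral_bernoulliEnergy`). With `ζ(2) = π² / 6` this becomes the stated sum, and the asymptotics
follow from `0 < H_N - log N - γ < 1 / N` and `1 / (N + 1) ≤ ∑_{k > N} 1 / k² ≤ 1 / N`.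
-/

/-! ### Finite subsets of the circle and the Bernoulli energy -/

/-- The points of a finite subset of the circle, represented in `[0, 1)` and listed in increasing
order. -/
theorem exists_strictMono_lift {A : Finset UnitAddCircle} {N : ℕ} (hN : A.card = N) :
    ∃ a : Fin N → ℝ, StrictMono a ∧ (∀ i, a i ∈ Set.Ico (0 : ℝ) 1) ∧
      Function.Injective (fun i => (a i : UnitAddCircle)) ∧
      A = Finset.univ.image (fun i => (a i : UnitAddCircle)) := by
  classical
  set f : UnitAddCircle → ℝ := fun q => (AddCircle.equivIco 1 0 q : ℝ) with hf
  have hcoe : ∀ q : UnitAddCircle, ((f q : ℝ) : UnitAddCircle) = q := fun q =>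
    (AddCircle.equivIco (1 : ℝ) 0).symm_apply_apply q
  have hinj : Function.Injective f := fun p q h => by rw [← hcoe p, ← hcoe q, h]
  have hmem : ∀ q, f q ∈ Set.Ico (0 : ℝ) 1 := fun q => by
    simpa using (AddCircle.equivIco (1 : ℝ) 0 q).2
  have hB : (A.image f).card = N := by rw [Finset.card_image_of_injective _ hinj, hN]
  set a := (A.image f).orderEmbOfFin hB with ha
  have hrange : ∀ i, ∃ q ∈ A, f q = a i := fun i =>
    Finset.mem_image.mp ((A.image f).orderEmbOfFin_mem hB i)
  have hA : A = Finset.univ.image (fun i => (a i : UnitAddCircle)) := by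
    ext q
    simp only [Finset.mem_image, Finset.mem_univ, true_and]
    constructor
    · intro hq
      have : f q ∈ Set.range a := by
        rw [ha, Finset.range_orderEmbOfFin]
        exact_mod_cast Finset.mem_image_of_mem f hq
      obtain ⟨i, hi⟩ := this
      exact ⟨i, by rw [hi, hcoe]⟩
    · rintro ⟨i, rfl⟩
      obtain ⟨q, hq, h⟩ := hrange i
      rw [← h, hcoe]
      exact hq
  refine ⟨a, a.strictMono, fun i => ?_, fun i j hij => ?_, hA⟩
  · obtain ⟨q, -, h⟩ := hrange i
    exact h ▸ hmem q
  · obtain ⟨p, -, hp⟩ := hrange i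
    obtain ⟨q, -, hq⟩ := hrange j
    apply a.injective
    simp only [← hp, ← hq, hcoe] at hij ⊢
    rw [hij]

theorem periodizedBernoulli_two_sub {a b : ℝ} (ha : a ∈ Set.Ico (0 : ℝ) 1)
    (hb : b ∈ Set.Ico (0 : ℝ) 1) :
    periodizedBernoulli 2 ((a : UnitAddCircle) - (b : UnitAddCircle))
      = (a - b) ^ 2 - |a - b| + 1 / 6 := by
  obtain ⟨ha0, ha1⟩ := ha
  obtain ⟨hb0, hb1⟩ := hb
  rcases le_total b a with h | h
  · rw [← AddCircle.coe_sub, periodizedBernoulli, AddCircle.liftIco_coe_apply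
      (show a - b ∈ Set.Ico (0 : ℝ) (0 + 1) from ⟨by linarith, by linarith⟩),
      bernoulliFun_two, abs_of_nonneg (by linarith)]
    norm_num
  · rcases h.eq_or_lt with rfl | h
    · rw [sub_self, ← AddCircle.coe_zero, periodizedBernoulli, AddCircle.liftIco_coe_apply
        (show (0 : ℝ) ∈ Set.Ico (0 : ℝ) (0 + 1) by norm_num), bernoulliFun_two]
      norm_num
    · have : (a : UnitAddCircle) - (b : UnitAddCircle) = ((a - b + 1 : ℝ) : UnitAddCircle) := by
        rw [AddCircle.coe_add, AddCircle.coe_period, add_zero, AddCircle.coe_sub]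
      rw [this, periodizedBernoulli, AddCircle.liftIco_coe_apply
        (show a - b + 1 ∈ Set.Ico (0 : ℝ) (0 + 1) from ⟨by linarith, by linarith⟩),
        bernoulliFun_two, abs_of_nonpos (by linarith)]
      ring

/-- The pair energy `∑_{p, q ∈ A} B₂(p - q)`, the diagonal `p = q` included, for the periodized
Bernoulli polynomial `B₂`. -/
noncomputable def bernoulliEnergy (A : Finset UnitAddCircle) : ℝ :=
  ∑ p ∈ A, ∑ q ∈ A, periodizedBernoulli 2 (p - q)

theorem bernoulliEnergy_eq {A : Finset UnitAddCircle} {N : ℕ} {a : Fin N → ℝ}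
    (ha : ∀ i, a i ∈ Set.Ico (0 : ℝ) 1)
    (hinj : Function.Injective (fun i => (a i : UnitAddCircle)))
    (hA : A = Finset.univ.image (fun i => (a i : UnitAddCircle))) :
    bernoulliEnergy A = ∑ i, ∑ j, ((a i - a j) ^ 2 - |a i - a j| + 1 / 6) := by
  classical
  rw [bernoulliEnergy, hA, Finset.sum_image (fun i _ j _ h => hinj h)]
  refine Finset.sum_congr rfl fun i _ => ?_
  rw [Finset.sum_image (fun i _ j _ h => hinj h)]
  exact Finset.sum_congr rfl fun j _ => periodizedBernoulli_two_sub (ha i) (ha j)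

/-! ### The periodic discrepancy -/

/-- Membership in the closed arc from `x` to `y`. For `x = y` the arc `Set.cIcc x y` is the whole
circle, in accordance with the second alternative. The value `a = 1`, a second representative of
`0`, is allowed because the measure on the circle is computed on `(0, 1]`. -/
theorem coe_mem_cIcc_iff {x y a : ℝ} (hx : x ∈ Set.Ioo (0 : ℝ) 1) (hy : y ∈ Set.Ioo (0 : ℝ) 1)
    (ha : a ∈ Set.Icc (0 : ℝ) 1) :
    (a : UnitAddCircle) ∈ Set.cIcc (x : UnitAddCircle) (y : UnitAddCircle) ↔
      if x < y then x ≤ a ∧ a ≤ y else x ≤ a ∨ a ≤ y := by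
  obtain ⟨hx0, hx1⟩ := hx
  obtain ⟨hy0, hy1⟩ := hy
  obtain ⟨ha0, ha1⟩ := ha
  have h1 : toIcoMod (one_pos : (0 : ℝ) < 1) x a = if x ≤ a then a else a + 1 := by
    rw [toIcoMod_eq_iff]
    split_ifs with h
    · exact ⟨⟨h, by linarith⟩, 0, by simp⟩
    · exact ⟨⟨by linarith, by linarith⟩, -1, by simp⟩
  have h2 : toIocMod (one_pos : (0 : ℝ) < 1) x y = if x < y then y else y + 1 := by
    rw [toIocMod_eq_iff]
    split_ifs with h
    · exact ⟨⟨h, by linarith⟩, 0, by simp⟩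
    · exact ⟨⟨by linarith, by linarith⟩, -1, by simp⟩
  have h3 : (a : UnitAddCircle) ∈ Set.cIcc (x : UnitAddCircle) (y : UnitAddCircle) ↔
      toIcoMod (one_pos : (0 : ℝ) < 1) x a ≤ toIocMod (one_pos : (0 : ℝ) < 1) x y :=
    QuotientAddGroup.btw_coe_iff
  rw [h3, h1, h2]
  split_ifs with h4 h5 h5 <;> grind

theorem volume_real_cIcc {x y : ℝ} (hx : x ∈ Set.Ioo (0 : ℝ) 1) (hy : y ∈ Set.Ioo (0 : ℝ) 1) :
    (volume : Measure UnitAddCircle).real (Set.cIcc (x : UnitAddCircle) (y : UnitAddCircle))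
      = if x < y then y - x else if x = y then 1 else y - x + 1 := by
  obtain ⟨hx0, hx1⟩ := id hx
  obtain ⟨hy0, hy1⟩ := id hy
  set I : Set ℝ := if x < y then Set.Icc x y else Set.Icc x 1 ∪ Set.Ioc 0 y with hI
  have hpre : ((↑) : ℝ → UnitAddCircle) ⁻¹' (Set.cIcc (x : UnitAddCircle) (y : UnitAddCircle))
      ∩ Set.Ioc 0 (0 + 1) = I := by
    ext t
    rw [zero_add]
    constructor
    · rintro ⟨h, ht0, ht1⟩
      rw [Set.mem_preimage, coe_mem_cIcc_iff hx hy ⟨ht0.le, ht1⟩] at h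
      rw [hI]
      split_ifs at h ⊢
      · exact h
      · rcases h with h | h
        · exact Or.inl ⟨h, ht1⟩
        · exact Or.inr ⟨ht0, h⟩
    · intro h
      have ht : t ∈ Set.Ioc (0 : ℝ) 1 := by
        rw [hI] at h
        split_ifs at h
        · exact ⟨hx0.trans_le h.1, h.2.trans hy1.le⟩
        · rcases h with h | h
          · exact ⟨hx0.trans_le h.1, h.2⟩
          · exact ⟨h.1, h.2.trans hy1.le⟩
      refine ⟨?_, ht⟩
      rw [Set.mem_preimage, coe_mem_cIcc_iff hx hy ⟨ht.1.le, ht.2⟩]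
      rw [hI] at h
      split_ifs at h ⊢
      · exact h
      · rcases h with h | h
        · exact Or.inl h.1
        · exact Or.inr h.2
  have hmeas : MeasurableSet (Set.cIcc (x : UnitAddCircle) (y : UnitAddCircle)) := by
    set g : UnitAddCircle → ℝ := fun q => (AddCircle.equivIco 1 0 q : ℝ) with hg
    have hgm : Measurable g :=
      measurable_subtype_coe.comp (AddCircle.measurableEquivIco 1 0).measurable
    have hcoe : ∀ q : UnitAddCircle, ((g q : ℝ) : UnitAddCircle) = q := fun q =>
      (AddCircle.equivIco (1 : ℝ) 0).symm_apply_apply q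
    have hmem : ∀ q, g q ∈ Set.Ico (0 : ℝ) 1 := fun q => by
      simpa using (AddCircle.equivIco (1 : ℝ) 0 q).2
    have : Set.cIcc (x : UnitAddCircle) (y : UnitAddCircle)
        = g ⁻¹' {a | if x < y then x ≤ a ∧ a ≤ y else x ≤ a ∨ a ≤ y} := by
      ext q
      have := coe_mem_cIcc_iff hx hy (Set.Ico_subset_Icc_self (hmem q))
      rw [hcoe] at this
      exact this
    rw [this]
    apply hgm
    split_ifs
    · exact measurableSet_Icc
    · exact measurableSet_Ici.union measurableSet_Iic
  rw [Measure.real, ← (UnitAddCircle.measurePreserving_mk 0).measure_preimage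
    hmeas.nullMeasurableSet, Measure.restrict_apply
    (AddCircle.measurable_mk' hmeas), hpre, hI]
  split_ifs with h1 h2
  · rw [Real.volume_Icc, ENNReal.toReal_ofReal (by linarith)]
  · subst h2
    have : Set.Icc x 1 ∪ Set.Ioc 0 x = Set.Ioc 0 1 := by
      ext t
      simp only [Set.mem_union, Set.mem_Icc, Set.mem_Ioc]
      constructor
      · rintro (h | h) <;> constructor <;> linarith [h.1, h.2]
      · intro h
        rcases le_total x t with h' | h'
        · exact Or.inl ⟨h', h.2⟩
        · exact Or.inr ⟨h.1, h'⟩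
    rw [this, Real.volume_Ioc]
    simp
  · have hlt : y < x := lt_of_le_of_ne (not_lt.mp h1) (Ne.symm h2)
    rw [measure_union _ measurableSet_Ioc, Real.volume_Icc, Real.volume_Ioc, ← ENNReal.ofReal_add
      (by linarith) (by linarith), ENNReal.toReal_ofReal (by linarith)]
    · ring
    · rw [Set.disjoint_left]
      intro t h h'
      linarith [h.1, h'.2]

/-- The contribution of one point to the local discrepancy of an arc splits into a function of the
initial point minus the same function of the end point. -/
theorem indicator_cIcc_sub_volume {x y a : ℝ} (hx : x ∈ Set.Ioo (0 : ℝ) 1)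
    (hy : y ∈ Set.Ioo (0 : ℝ) 1) (ha : a ∈ Set.Ico (0 : ℝ) 1) (hxy : x ≠ y) (hax : a ≠ x)
    [Decidable ((a : UnitAddCircle) ∈ Set.cIcc (x : UnitAddCircle) (y : UnitAddCircle))] :
    (if (a : UnitAddCircle) ∈ Set.cIcc (x : UnitAddCircle) (y : UnitAddCircle) then (1 : ℝ) else 0)
      - (volume : Measure UnitAddCircle).real (Set.cIcc (x : UnitAddCircle) (y : UnitAddCircle))
      = (x + if x < a then 1 else 0) - (y + if y < a then 1 else 0) := by
  rw [volume_real_cIcc hx hy, if_neg hxy]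
  have h := coe_mem_cIcc_iff hx hy (Set.Ico_subset_Icc_self ha)
  by_cases hc : (a : UnitAddCircle) ∈ Set.cIcc (x : UnitAddCircle) (y : UnitAddCircle)
  · rw [if_pos hc]
    rw [h] at hc
    grind
  · rw [if_neg hc]
    rw [h] at hc
    grind

/-- The function `x + |{i : x < a i}| / N`, whose increments are the local discrepancies of arcs.
-/
noncomputable def countingHeight {N : ℕ} (a : Fin N → ℝ) (x : ℝ) : ℝ :=
  x + (N : ℝ)⁻¹ * ∑ i, if x < a i then 1 else 0

theorem discrepancy_eq_countingHeight_sub {A : Finset UnitAddCircle} {N : ℕ} (hN : N ≠ 0)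
    {a : Fin N → ℝ} (ha : ∀ i, a i ∈ Set.Ico (0 : ℝ) 1)
    (hinj : Function.Injective (fun i => (a i : UnitAddCircle)))
    (hA : A = Finset.univ.image (fun i => (a i : UnitAddCircle)))
    {x y : ℝ} (hx : x ∈ Set.Ioo (0 : ℝ) 1) (hy : y ∈ Set.Ioo (0 : ℝ) 1) (hxy : x ≠ y)
    (hax : ∀ i, a i ≠ x) :
    (((A : Set UnitAddCircle) ∩ Set.cIcc (x : UnitAddCircle) y).ncard : ℝ) / (A.card : ℝ)
      - (volume : Measure UnitAddCircle).real (Set.cIcc (x : UnitAddCircle) y)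
      = countingHeight a x - countingHeight a y := by
  classical
  have hcard : A.card = N := by
    rw [hA, Finset.card_image_of_injective _ hinj, Finset.card_univ, Fintype.card_fin]
  have hcount : (((A : Set UnitAddCircle) ∩ Set.cIcc (x : UnitAddCircle) y).ncard : ℝ)
      = ∑ i, if (a i : UnitAddCircle) ∈ Set.cIcc (x : UnitAddCircle) y then (1 : ℝ) else 0 := by
    have : (A : Set UnitAddCircle) ∩ Set.cIcc (x : UnitAddCircle) y
        = ((A.filter (· ∈ Set.cIcc (x : UnitAddCircle) y) : Finset UnitAddCircle) :
            Set UnitAddCircle) := by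
      ext; simp
    rw [this, Set.ncard_coe_finset, Finset.card_filter, hA,
      Finset.sum_image (fun i _ j _ h => hinj h)]
    push_cast
    rfl
  have hN' : (N : ℝ) ≠ 0 := Nat.cast_ne_zero.mpr hN
  have hsum := Finset.sum_congr rfl fun i (_ : i ∈ Finset.univ) =>
    indicator_cIcc_sub_volume hx hy (ha i) hxy (hax i)
  simp only [Finset.sum_sub_distrib, Finset.sum_add_distrib, Finset.sum_const, Finset.card_univ,
    Fintype.card_fin, nsmul_eq_mul] at hsum
  rw [hcount, hcard, countingHeight, countingHeight]
  field_simp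
  linarith

theorem intervalIntegrable_ite_lt {f : ℝ → ℝ} (hf : Continuous f) (a u v : ℝ) :
    IntervalIntegrable (fun x => if x < a then f x else 0) volume u v := by
  have : (fun x => if x < a then f x else 0) = (Set.Iio a).indicator f := by
    ext x; simp [Set.indicator]
  rw [this, intervalIntegrable_iff]
  exact (intervalIntegrable_iff.mp (hf.intervalIntegrable u v)).indicator measurableSet_Iio

theorem intervalIntegrable_finset_sum {ι : Type*} (s : Finset ι) {f : ι → ℝ → ℝ} {u v : ℝ}
    (h : ∀ i ∈ s, IntervalIntegrable (f i) volume u v) :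
    IntervalIntegrable (fun x => ∑ i ∈ s, f i x) volume u v := by
  simpa only [Finset.sum_fn] using IntervalIntegrable.sum s h

theorem integral_ite_lt {f : ℝ → ℝ} (hf : Continuous f) {a : ℝ} (ha : a ∈ Set.Icc (0 : ℝ) 1) :
    ∫ x in (0 : ℝ)..1, (if x < a then f x else 0) = ∫ x in (0 : ℝ)..a, f x := by
  rw [← intervalIntegral.integral_add_adjacent_intervals
    (intervalIntegrable_ite_lt hf a 0 a) (intervalIntegrable_ite_lt hf a a 1)]
  have h1 : ∫ x in (0 : ℝ)..a, (if x < a then f x else 0) = ∫ x in (0 : ℝ)..a, f x := by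
    refine intervalIntegral.integral_congr_ae ?_
    filter_upwards [Measure.ae_ne volume a] with x hx hx'
    rw [Set.uIoc_of_le ha.1] at hx'
    rw [if_pos (lt_of_le_of_ne hx'.2 hx)]
  have h2 : ∫ x in a..(1 : ℝ), (if x < a then f x else 0) = 0 := by
    refine intervalIntegral.integral_zero_ae (ae_of_all _ fun x hx => ?_)
    rw [Set.uIoc_of_le ha.2] at hx
    rw [if_neg (not_lt.mpr hx.1.le)]
  rw [h1, h2, add_zero]

theorem countingHeight_sq {N : ℕ} (a : Fin N → ℝ) (x : ℝ) :
    countingHeight a x ^ 2 = x ^ 2 + ((N : ℝ)⁻¹ * ∑ i, (if x < a i then 2 * x else 0)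
      + (N : ℝ)⁻¹ ^ 2 * ∑ i, ∑ j, if x < min (a i) (a j) then 1 else 0) := by
  have h1 : (∑ i, if x < a i then 2 * x else 0) = 2 * x * ∑ i, if x < a i then (1 : ℝ) else 0 := by
    rw [Finset.mul_sum]; exact Finset.sum_congr rfl fun i _ => by split_ifs <;> simp
  have h2 : (∑ i, ∑ j, if x < min (a i) (a j) then (1 : ℝ) else 0)
      = (∑ i, if x < a i then (1 : ℝ) else 0) ^ 2 := by
    rw [sq, Finset.sum_mul_sum]
    refine Finset.sum_congr rfl fun i _ => Finset.sum_congr rfl fun j _ => ?_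
    simp only [lt_min_iff]
    split_ifs <;> simp_all
  rw [h1, h2, countingHeight]
  ring

theorem intervalIntegrable_countingHeight {N : ℕ} (a : Fin N → ℝ) (u v : ℝ) :
    IntervalIntegrable (countingHeight a) volume u v := by
  unfold countingHeight
  refine (continuous_id.intervalIntegrable u v).add (IntervalIntegrable.const_mul ?_ _)
  exact intervalIntegrable_finset_sum _
    fun i _ => intervalIntegrable_ite_lt continuous_const (a i) u v

theorem intervalIntegrable_countingHeight_sq {N : ℕ} (a : Fin N → ℝ) (u v : ℝ) :
    IntervalIntegrable (fun x => countingHeight a x ^ 2) volume u v := by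
  simp_rw [countingHeight_sq]
  refine ((continuous_pow 2).intervalIntegrable u v).add
    ((IntervalIntegrable.const_mul ?_ _).add (IntervalIntegrable.const_mul ?_ _))
  · exact intervalIntegrable_finset_sum _
      fun i _ => intervalIntegrable_ite_lt (by fun_prop) (a i) u v
  · exact intervalIntegrable_finset_sum _ fun i _ => intervalIntegrable_finset_sum _
      fun j _ => intervalIntegrable_ite_lt continuous_const _ u v

theorem integral_countingHeight {N : ℕ} {a : Fin N → ℝ} (ha : ∀ i, a i ∈ Set.Ico (0 : ℝ) 1) :
    ∫ x in (0 : ℝ)..1, countingHeight a x = 1 / 2 + (N : ℝ)⁻¹ * ∑ i, a i := by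
  unfold countingHeight
  have h : ∀ i ∈ Finset.univ, IntervalIntegrable (fun x => if x < a i then (1 : ℝ) else 0)
      volume 0 1 := fun i _ => intervalIntegrable_ite_lt continuous_const (a i) 0 1
  rw [intervalIntegral.integral_add (continuous_id'.intervalIntegrable 0 1)
    (IntervalIntegrable.const_mul (intervalIntegrable_finset_sum _ h) _),
    intervalIntegral.integral_const_mul, intervalIntegral.integral_finsetSum h]
  simp_rw [fun i => integral_ite_lt (continuous_const (y := (1 : ℝ)))
    (Set.Ico_subset_Icc_self (ha i))]
  simp

theorem integral_countingHeight_sq {N : ℕ} {a : Fin N → ℝ} (ha : ∀ i, a i ∈ Set.Ico (0 : ℝ) 1) :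
    ∫ x in (0 : ℝ)..1, countingHeight a x ^ 2 = 1 / 3 + ((N : ℝ)⁻¹ * ∑ i, a i ^ 2
      + (N : ℝ)⁻¹ ^ 2 * ∑ i, ∑ j, min (a i) (a j)) := by
  simp_rw [countingHeight_sq]
  have h1 : ∀ i ∈ Finset.univ, IntervalIntegrable (fun x => if x < a i then 2 * x else 0)
      volume 0 1 := fun i _ => intervalIntegrable_ite_lt (by fun_prop) (a i) 0 1
  have h2 : ∀ i, ∀ j ∈ Finset.univ, IntervalIntegrable
      (fun x => if x < min (a i) (a j) then (1 : ℝ) else 0)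
      volume 0 1 := fun i j _ => intervalIntegrable_ite_lt continuous_const _ 0 1
  have h3 : ∀ i ∈ Finset.univ, IntervalIntegrable
      (fun x => ∑ j, if x < min (a i) (a j) then (1 : ℝ) else 0) volume 0 1 :=
    fun i _ => intervalIntegrable_finset_sum _ (h2 i)
  have i1 := IntervalIntegrable.const_mul (intervalIntegrable_finset_sum _ h1) (N : ℝ)⁻¹
  have i2 := IntervalIntegrable.const_mul (intervalIntegrable_finset_sum _ h3)
    ((N : ℝ)⁻¹ ^ 2)
  rw [intervalIntegral.integral_add ((continuous_pow 2).intervalIntegrable 0 1) (i1.add i2),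
    intervalIntegral.integral_add i1 i2,
    intervalIntegral.integral_const_mul, intervalIntegral.integral_const_mul,
    intervalIntegral.integral_finsetSum h1, intervalIntegral.integral_finsetSum h3]
  simp_rw [fun i => intervalIntegral.integral_finsetSum (h2 i)]
  simp_rw [fun i => integral_ite_lt (f := fun x => 2 * x) (by fun_prop)
    (Set.Ico_subset_Icc_self (ha i)), fun i j => integral_ite_lt (continuous_const (y := (1 : ℝ)))
    (a := min (a i) (a j)) ⟨le_min (ha i).1 (ha j).1, (min_le_left _ _).trans (ha i).2.le⟩]
  have hsq : ∀ c : ℝ, ∫ x in (0 : ℝ)..c, 2 * x = c ^ 2 := fun c => by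
    rw [intervalIntegral.integral_const_mul, integral_id]; ring
  simp_rw [hsq]
  simp
  norm_num

/-- The mean squared increment is twice the variance. -/
theorem integral_integral_sub_sq {h : ℝ → ℝ} (h1 : IntervalIntegrable h volume 0 1)
    (h2 : IntervalIntegrable (fun x => h x ^ 2) volume 0 1) :
    ∫ y in (0 : ℝ)..1, ∫ x in (0 : ℝ)..1, (h x - h y) ^ 2
      = 2 * (∫ x in (0 : ℝ)..1, h x ^ 2) - 2 * (∫ x in (0 : ℝ)..1, h x) ^ 2 := by
  have hin : ∀ y, ∫ x in (0 : ℝ)..1, (h x - h y) ^ 2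
      = (∫ x in (0 : ℝ)..1, h x ^ 2) + ((-2 * ∫ x in (0 : ℝ)..1, h x) * h y + h y ^ 2) := by
    intro y
    have : ∀ x, (h x - h y) ^ 2 = h x ^ 2 + ((-2 * h y) * h x + h y ^ 2) := fun x => by ring
    simp_rw [this]
    rw [intervalIntegral.integral_add h2 ((h1.const_mul _).add intervalIntegrable_const),
      intervalIntegral.integral_add (h1.const_mul _) intervalIntegrable_const,
      intervalIntegral.integral_const_mul]
    simp
    ring
  simp_rw [hin]
  rw [intervalIntegral.integral_add intervalIntegrable_const ((h1.const_mul _).add h2),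
      intervalIntegral.integral_add (h1.const_mul _) h2,
      intervalIntegral.integral_const_mul]
  simp
  ring

theorem periodicDiscrepancy_sq {A : Finset UnitAddCircle} {N : ℕ} (hN : N ≠ 0)
    (hcard : A.card = N) :
    periodicDiscrepancy A ^ 2 = 1 / (N : ℝ) ^ 2 * bernoulliEnergy A := by
  obtain ⟨a, -, ha, hinj, hA⟩ := exists_strictMono_lift hcard
  have hN' : (N : ℝ) ≠ 0 := Nat.cast_ne_zero.mpr hN
  -- The decomposition of the local discrepancy needs end points that avoid `0`, each other and `A`.
  have haway : ∀ᵐ x : ℝ, ∀ i, a i ≠ x := by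
    rw [ae_all_iff]
    intro i
    filter_upwards [Measure.ae_ne volume (a i)] with x hx using hx.symm
  have hne1 := Measure.ae_ne (volume : Measure ℝ) 1
  rw [periodicDiscrepancy, Real.sq_sqrt (integral_nonneg fun y => integral_nonneg fun x =>
    sq_nonneg _), ← UnitAddCircle.intervalIntegral_preimage 0]
  simp_rw [← UnitAddCircle.intervalIntegral_preimage 0, zero_add, sq_abs]
  have hcongr : ∫ y in (0 : ℝ)..1, ∫ x in (0 : ℝ)..1,
      ((((A : Set UnitAddCircle) ∩ Set.cIcc (x : UnitAddCircle) y).ncard : ℝ) / (A.card : ℝ)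
      - (volume : Measure UnitAddCircle).real (Set.cIcc (x : UnitAddCircle) y)) ^ 2
      = ∫ y in (0 : ℝ)..1, ∫ x in (0 : ℝ)..1, (countingHeight a x - countingHeight a y) ^ 2 := by
    refine intervalIntegral.integral_congr_ae ?_
    filter_upwards [hne1] with y hy1 hy
    rw [Set.uIoc_of_le zero_le_one] at hy
    refine intervalIntegral.integral_congr_ae ?_
    filter_upwards [hne1, haway, Measure.ae_ne volume y] with x hx1 hax hxy hx
    rw [Set.uIoc_of_le zero_le_one] at hx
    rw [discrepancy_eq_countingHeight_sub hN ha hinj hA ⟨hx.1, lt_of_le_of_ne hx.2 hx1⟩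
      ⟨hy.1, lt_of_le_of_ne hy.2 hy1⟩ hxy hax]
  rw [hcongr, integral_integral_sub_sq (intervalIntegrable_countingHeight a 0 1)
    (intervalIntegrable_countingHeight_sq a 0 1), integral_countingHeight ha,
    integral_countingHeight_sq ha, bernoulliEnergy_eq ha hinj hA]
  have hmin : ∀ i j, (a i - a j) ^ 2 - |a i - a j| + 1 / 6
      = a i ^ 2 + a j ^ 2 - 2 * (a i * a j) - (a i + a j) + 2 * min (a i) (a j) + 1 / 6 := by
    intro i j
    rcases le_total (a i) (a j) with h | h
    · rw [min_eq_left h, abs_of_nonpos (by linarith)]; ring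
    · rw [min_eq_right h, abs_of_nonneg (by linarith)]; ring
  simp_rw [hmin]
  simp only [Finset.sum_add_distrib, Finset.sum_sub_distrib, ← Finset.mul_sum, ← Finset.sum_mul,
    Finset.sum_const, Finset.card_univ, Fintype.card_fin, nsmul_eq_mul]
  field_simp
  ring

/-! ### Monotone rearrangement on the circle -/

/-- The map `S` that sends the cell `[θ + m / N, θ + (m + 1) / N)` of the real line to `α m`, for
every integer `m`. -/
noncomputable def cellMap (N : ℕ) (α : ℤ → ℝ) (θ : ℝ) (y : ℝ) : ℝ :=
  α ⌊(N : ℝ) * (y - θ)⌋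

/-- The quadratic cost of transporting the cells `[θ + i / N, θ + (i + 1) / N]`, `i < N`, to the
points `α i`, measured on the real line. -/
noncomputable def cellCost (N : ℕ) (α : ℤ → ℝ) (θ : ℝ) : ℝ :=
  ∑ i ∈ Finset.range N,
    ∫ y in (θ + (i : ℕ) / (N : ℝ))..(θ + ((i + 1 : ℕ) : ℝ) / (N : ℝ)), (α i - y) ^ 2

section CellMap

variable {N : ℕ} {α : ℤ → ℝ} {θ : ℝ}

theorem monotone_cellMap (hα : Monotone α) : Monotone (cellMap N α θ) := fun x y h =>
  hα (Int.floor_le_floor (by gcongr))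

theorem cellMap_add_one (hper : ∀ m, α (m + N) = α m + 1) (y : ℝ) :
    cellMap N α θ (y + 1) = cellMap N α θ y + 1 := by
  rw [cellMap, cellMap, ← hper, ← Int.floor_add_natCast]
  congr 2
  ring

theorem cellMap_eq (hN : N ≠ 0) (i : ℕ) {y : ℝ}
    (hy : y ∈ Set.Ico (θ + (i : ℕ) / (N : ℝ)) (θ + ((i + 1 : ℕ) : ℝ) / (N : ℝ))) :
    cellMap N α θ y = α i := by
  have hN' : (0 : ℝ) < N := by positivity
  rw [cellMap]
  congr 1
  rw [Int.floor_eq_iff]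
  obtain ⟨h1, h2⟩ := hy
  push_cast at h2 ⊢
  have h1' : (i : ℝ) / N ≤ y - θ := by linarith
  have h2' : y - θ < ((i : ℝ) + 1) / N := by linarith
  rw [div_le_iff₀ hN'] at h1'
  rw [lt_div_iff₀ hN'] at h2'
  constructor <;> linarith

theorem cell_le (i : ℕ) : θ + (i : ℕ) / (N : ℝ) ≤ θ + ((i + 1 : ℕ) : ℝ) / (N : ℝ) := by
  gcongr
  simp

theorem mul_sub_le_integral_of_monotone {S : ℝ → ℝ} (hS : Monotone S) (y z : ℝ) :
    S y * (z - y) ≤ ∫ t in y..z, S t := by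
  rcases le_total y z with h | h
  · have := intervalIntegral.integral_mono_on h (intervalIntegrable_const (μ := volume) (c := S y))
      hS.intervalIntegrable (fun t ht => hS ht.1)
    simp only [intervalIntegral.integral_const, smul_eq_mul] at this
    linarith
  · have := intervalIntegral.integral_mono_on h
      hS.intervalIntegrable (intervalIntegrable_const (μ := volume) (c := S y)) (fun t ht => hS ht.2)
    simp only [intervalIntegral.integral_const, smul_eq_mul] at this
    rw [intervalIntegral.integral_symm]
    linarith

/-- The Kantorovich potential `ψ z = 2 ∫_θ^z (t - S t) dt` on the uniform side, where `S` is the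
cell map. -/
noncomputable def transportPotential (N : ℕ) (α : ℤ → ℝ) (θ : ℝ) (z : ℝ) : ℝ :=
  2 * ∫ t in θ..z, (t - cellMap N α θ t)

theorem intervalIntegrable_sub_cellMap (hα : Monotone α) (u v : ℝ) :
    IntervalIntegrable (fun t => t - cellMap N α θ t) volume u v :=
  (continuous_id'.intervalIntegrable u v).sub (monotone_cellMap hα).intervalIntegrable

theorem continuous_transportPotential (hα : Monotone α) :
    Continuous (transportPotential N α θ) :=
  continuous_const.mul
    (intervalIntegral.continuous_primitive (intervalIntegrable_sub_cellMap hα) θ)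

theorem periodic_transportPotential (hα : Monotone α) (hper : ∀ m, α (m + N) = α m + 1)
    (hθ : ∫ t in θ..θ + 1, (t - cellMap N α θ t) = 0) :
    Function.Periodic (transportPotential N α θ) 1 := by
  intro z
  have hp : Function.Periodic (fun t => t - cellMap N α θ t) 1 := fun t => by
    simp only [cellMap_add_one hper]; ring
  rw [transportPotential, transportPotential,
    ← intervalIntegral.integral_add_adjacent_intervals (intervalIntegrable_sub_cellMap hα θ z)
      (intervalIntegrable_sub_cellMap hα z (z + 1)), hp.intervalIntegral_add_eq z θ, hθ, add_zero]

/-- The function `z ↦ z² - ψ z` is convex with subgradient `2 S y` at `y`; equivalently, `z ↦ (S y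
- z)² - ψ z` is minimal at `z = y`. -/
theorem transportPotential_le (hα : Monotone α) (y z : ℝ) :
    (cellMap N α θ y - y) ^ 2 - transportPotential N α θ y
      ≤ (cellMap N α θ y - z) ^ 2 - transportPotential N α θ z := by
  have h1 : (∫ t in θ..z, (t - cellMap N α θ t)) - ∫ t in θ..y, (t - cellMap N α θ t)
      = ∫ t in y..z, (t - cellMap N α θ t) :=
    intervalIntegral.integral_interval_sub_left (intervalIntegrable_sub_cellMap hα θ z)
      (intervalIntegrable_sub_cellMap hα θ y)
  have h2 : ∫ t in y..z, (t - cellMap N α θ t)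
      = (z ^ 2 - y ^ 2) / 2 - ∫ t in y..z, cellMap N α θ t := by
    rw [intervalIntegral.integral_sub (continuous_id'.intervalIntegrable y z)
      (monotone_cellMap hα).intervalIntegrable, integral_id]
  have h3 := mul_sub_le_integral_of_monotone (monotone_cellMap (N := N) (θ := θ) hα) y z
  rw [transportPotential, transportPotential]
  nlinarith

theorem sum_integral_cells (hN : N ≠ 0) {f : ℝ → ℝ}
    (hf : ∀ u v, IntervalIntegrable f volume u v) :
    ∑ i ∈ Finset.range N,
      ∫ y in (θ + (i : ℕ) / (N : ℝ))..(θ + ((i + 1 : ℕ) : ℝ) / (N : ℝ)), f y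
      = ∫ y in θ..θ + 1, f y := by
  have := intervalIntegral.sum_integral_adjacent_intervals (f := f) (μ := volume) (n := N)
    (a := fun i : ℕ => θ + (i : ℝ) / (N : ℝ)) (fun k _ => hf _ _)
  rw [this]
  have hN' : (N : ℝ) ≠ 0 := Nat.cast_ne_zero.mpr hN
  simp [div_self hN']

/-- The Kantorovich potential at the point `α i`: the mean of `(α i - y)² - ψ y` over the `i`-th
cell. Taking the mean makes `sum_dualPotential` immediate, with no need to know that the function
is constant on the cell. -/
noncomputable def dualPotential (N : ℕ) (α : ℤ → ℝ) (θ : ℝ) (i : ℕ) : ℝ :=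
  N * ∫ y in (θ + (i : ℕ) / (N : ℝ))..(θ + ((i + 1 : ℕ) : ℝ) / (N : ℝ)),
    ((α i - y) ^ 2 - transportPotential N α θ y)

/-- Dual feasibility of the pair of potentials for the quadratic cost on the real line. -/
theorem dualPotential_add_le (hN : N ≠ 0) (hα : Monotone α) (i : ℕ) (z : ℝ) :
    dualPotential N α θ i + transportPotential N α θ z ≤ (α i - z) ^ 2 := by
  have hN' : (0 : ℝ) < N := by positivity
  have hc : Continuous fun y => (α i - y) ^ 2 - transportPotential N α θ y :=
    (by fun_prop : Continuous fun y => (α i - y) ^ 2).sub (continuous_transportPotential hα)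
  have := intervalIntegral.integral_mono_on_of_le_Ioo (cell_le (N := N) (θ := θ) i)
    (hc.intervalIntegrable _ _)
    (intervalIntegrable_const (μ := volume) (c := (α i - z) ^ 2 - transportPotential N α θ z))
    (fun y hy => by
      have h := transportPotential_le (N := N) (θ := θ) hα y z
      rwa [cellMap_eq hN i (Set.Ioo_subset_Ico_self hy)] at h)
  rw [intervalIntegral.integral_const, smul_eq_mul] at this
  have h2 := mul_le_mul_of_nonneg_left this hN'.le
  have h3 : (N : ℝ) * ((θ + ((i + 1 : ℕ) : ℝ) / N - (θ + (i : ℝ) / N))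
      * ((α i - z) ^ 2 - transportPotential N α θ z))
      = (α i - z) ^ 2 - transportPotential N α θ z := by
    push_cast
    field_simp
    ring
  rw [h3] at h2
  rw [dualPotential]
  linarith

/-- The dual value of the pair of potentials is the cost of the cell map. -/
theorem sum_dualPotential (hN : N ≠ 0) (hα : Monotone α) :
    (N : ℝ)⁻¹ * ∑ i ∈ Finset.range N, dualPotential N α θ i
      + ∫ z in θ..θ + 1, transportPotential N α θ z = cellCost N α θ := by
  have hN' : (N : ℝ) ≠ 0 := Nat.cast_ne_zero.mpr hN
  have hc := continuous_transportPotential (N := N) (θ := θ) hα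
  rw [← sum_integral_cells hN (fun u v => hc.intervalIntegrable u v), cellCost, Finset.mul_sum,
    ← Finset.sum_add_distrib]
  refine Finset.sum_congr rfl fun i _ => ?_
  rw [dualPotential, inv_mul_cancel_left₀ hN', intervalIntegral.integral_sub
    ((by fun_prop : Continuous fun y => (α i - y) ^ 2).intervalIntegrable _ _)
    (hc.intervalIntegrable _ _)]
  ring

end CellMap

/-! ### The quadratic Wasserstein distance to the uniform measure -/

theorem dist_coe_le (a y : ℝ) : dist (a : UnitAddCircle) (y : UnitAddCircle) ≤ |a - y| := by
  rw [dist_eq_norm, ← AddCircle.coe_sub, UnitAddCircle.norm_eq]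
  simpa using round_le (a - y) 0

theorem exists_dist_coe_eq (a y : ℝ) :
    ∃ n : ℤ, dist (a : UnitAddCircle) (y : UnitAddCircle) = |a - (y + n)| := by
  refine ⟨round (a - y), ?_⟩
  rw [dist_eq_norm, ← AddCircle.coe_sub, UnitAddCircle.norm_eq]
  congr 1
  ring

theorem lintegral_edist_sq_eq (π : Measure (UnitAddCircle × UnitAddCircle)) [IsFiniteMeasure π] :
    ∫⁻ z, edist z.1 z.2 ^ (2 : ℝ) ∂π = ENNReal.ofReal (∫ z, dist z.1 z.2 ^ 2 ∂π) := by
  have hc : Continuous fun z : UnitAddCircle × UnitAddCircle => dist z.1 z.2 ^ 2 := by fun_prop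
  have hint : Integrable (fun z : UnitAddCircle × UnitAddCircle => dist z.1 z.2 ^ 2) π :=
    hc.integrable_of_hasCompactSupport (HasCompactSupport.of_compactSpace _)
  rw [ofReal_integral_eq_lintegral_ofReal hint (ae_of_all _ fun z => sq_nonneg _)]
  refine lintegral_congr fun z => ?_
  rw [edist_dist, ENNReal.rpow_two, ENNReal.ofReal_pow dist_nonneg]

section Wasserstein

variable {N : ℕ} {α : ℤ → ℝ} {θ : ℝ} {A : Finset UnitAddCircle}

theorem empiricalMeasure_eq (hinj : Set.InjOn (fun i : ℕ => (α i : UnitAddCircle)) (Finset.range N))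
    (hA : A = (Finset.range N).image fun i : ℕ => (α i : UnitAddCircle)) :
    empiricalMeasure A = (N : ℝ≥0∞)⁻¹ •
      ∑ i ∈ Finset.range N, Measure.dirac (α i : UnitAddCircle) := by
  classical
  rw [empiricalMeasure, hA, Finset.card_image_of_injOn hinj, Finset.card_range,
    Finset.sum_image hinj]

/-- Kantorovich's lower bound: the potentials descend to the circle because the mean of `t - S t`
over a period vanishes. -/
theorem cellCost_le_of_isCoupling (hN : N ≠ 0) (hα : Monotone α)
    (hper : ∀ m, α (m + N) = α m + 1)
    (hθ : ∫ t in θ..θ + 1, (t - cellMap N α θ t) = 0)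
    (hinj : Set.InjOn (fun i : ℕ => (α i : UnitAddCircle)) (Finset.range N))
    (hA : A = (Finset.range N).image fun i : ℕ => (α i : UnitAddCircle))
    {π : Measure (UnitAddCircle × UnitAddCircle)}
    (hπ : IsCoupling π (empiricalMeasure A) volume) :
    ENNReal.ofReal (cellCost N α θ) ≤ ∫⁻ z, edist z.1 z.2 ^ (2 : ℝ) ∂π := by
  classical
  obtain ⟨h1, h2⟩ := hπ
  have hprob : IsProbabilityMeasure π := by
    constructor
    have := congrArg (fun μ => μ Set.univ) h2
    rwa [Measure.map_apply measurable_snd MeasurableSet.univ, Set.preimage_univ,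
      UnitAddCircle.measure_univ] at this
  rw [lintegral_edist_sq_eq]
  refine ENNReal.ofReal_le_ofReal ?_
  have hpp := periodic_transportPotential hα hper hθ
  set Ψ : UnitAddCircle → ℝ := hpp.lift with hΨ
  have hΨc : Continuous Ψ := (continuous_transportPotential hα).quotient_lift _
  have hΨcoe : ∀ z : ℝ, Ψ (z : UnitAddCircle) = transportPotential N α θ z := fun z =>
    hpp.lift_coe z
  -- Only the values of `Φ` on `A` matter, as the first marginal is carried by `A`.
  set Φ : UnitAddCircle → ℝ := fun p => ∑ i ∈ Finset.range N,
    if p = (α i : UnitAddCircle) then dualPotential N α θ i else 0 with hΦ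
  have hΦm : Measurable Φ := Finset.measurable_sum _ fun i _ =>
    Measurable.ite (measurableSet_singleton _) measurable_const measurable_const
  have hΦα : ∀ j ∈ Finset.range N, Φ (α j : UnitAddCircle) = dualPotential N α θ j := by
    intro j hj
    rw [hΦ]
    simp only
    rw [Finset.sum_eq_single_of_mem j hj (fun i hi hij => if_neg fun h => hij (hinj hi hj h.symm)),
      if_pos rfl]
  have hΨint : Integrable Ψ (volume : Measure UnitAddCircle) :=
    hΨc.integrable_of_hasCompactSupport (HasCompactSupport.of_compactSpace _)
  have hemp := empiricalMeasure_eq hinj hA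
  have hΦint : Integrable Φ (empiricalMeasure A) := by
    rw [hemp]
    refine Integrable.smul_measure ?_ (by simp [hN])
    exact integrable_finsetSum_measure.mpr fun i _ => integrable_dirac (by simp)
  have hΦval : ∫ p, Φ p ∂(empiricalMeasure A)
      = (N : ℝ)⁻¹ * ∑ i ∈ Finset.range N, dualPotential N α θ i := by
    rw [hemp, integral_smul_measure, integral_finsetSum_measure
      (fun i _ => integrable_dirac (by simp))]
    simp only [integral_dirac, ENNReal.toReal_inv, ENNReal.toReal_natCast, smul_eq_mul]
    rw [Finset.sum_congr rfl hΦα]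
  have hΨval : ∫ q : UnitAddCircle, Ψ q = ∫ z in θ..θ + 1, transportPotential N α θ z := by
    rw [← UnitAddCircle.intervalIntegral_preimage θ]
    simp_rw [hΨcoe]
  rw [← h1] at hΦint hΦval
  rw [← h2] at hΨint hΨval
  rw [integral_map measurable_fst.aemeasurable hΦm.aestronglyMeasurable] at hΦval
  rw [integral_map measurable_snd.aemeasurable hΨc.aestronglyMeasurable] at hΨval
  have hΦint' : Integrable (fun z => Φ z.1) π := hΦint.comp_measurable measurable_fst
  have hΨint' : Integrable (fun z => Ψ z.2) π := hΨint.comp_measurable measurable_snd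
  rw [← sum_dualPotential hN hα, ← hΦval, ← hΨval, ← integral_add hΦint' hΨint']
  have hc : Continuous fun z : UnitAddCircle × UnitAddCircle => dist z.1 z.2 ^ 2 := by fun_prop
  refine integral_mono_ae (hΦint'.add hΨint')
    (hc.integrable_of_hasCompactSupport (HasCompactSupport.of_compactSpace _)) ?_
  have hae : ∀ᵐ z ∂π, z.1 ∈ A := by
    have : ∀ᵐ p ∂(π.map Prod.fst), p ∈ A := by
      rw [h1, hemp, ae_iff, Measure.smul_apply, Measure.finsetSum_apply, Finset.sum_eq_zero]
      · simp
      · intro i hi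
        have hmem : (α i : UnitAddCircle) ∈ A := hA ▸ Finset.mem_image_of_mem _ hi
        have hset : {p | p ∉ A} = (A : Set UnitAddCircle)ᶜ := rfl
        rw [hset, Measure.dirac_apply' _ (A.measurableSet.compl)]
        simp [hmem]
    exact ae_of_ae_map measurable_fst.aemeasurable this
  filter_upwards [hae] with z hz
  rw [hA, Finset.mem_image] at hz
  obtain ⟨i, hi, hiz⟩ := hz
  obtain ⟨y, hy⟩ := QuotientAddGroup.mk_surjective z.2
  have hy' : (y : UnitAddCircle) = z.2 := hy
  rw [← hiz, ← hy', hΦα i hi]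
  -- The distance is realized by some representative `y + n`, where `ψ` has the same value.
  obtain ⟨n, hn⟩ := exists_dist_coe_eq (α i) y
  rw [hn, sq_abs, hΨcoe]
  have := dualPotential_add_le (θ := θ) hN hα i (y + n)
  have hp : transportPotential N α θ (y + n) = transportPotential N α θ y := by
    simpa using hpp.int_mul n y
  linarith

theorem sum_restrict_cells (hN : N ≠ 0) :
    ∑ i ∈ Finset.range N,
      (volume : Measure ℝ).restrict
        (Set.Ioc (θ + (i : ℕ) / (N : ℝ)) (θ + ((i + 1 : ℕ) : ℝ) / (N : ℝ)))
      = volume.restrict (Set.Ioc θ (θ + 1)) := by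
  have h : ∀ n : ℕ, ∑ i ∈ Finset.range n,
      (volume : Measure ℝ).restrict
        (Set.Ioc (θ + (i : ℕ) / (N : ℝ)) (θ + ((i + 1 : ℕ) : ℝ) / (N : ℝ)))
      = volume.restrict (Set.Ioc θ (θ + n / (N : ℝ))) := by
    intro n
    induction n with
    | zero => simp
    | succ n ih =>
      rw [Finset.sum_range_succ, ih, ← Measure.restrict_union _ measurableSet_Ioc,
        Set.Ioc_union_Ioc_eq_Ioc _ (cell_le n)]
      · simp only [le_add_iff_nonneg_right]; positivity
      · rw [Set.disjoint_left]
        intro t h h'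
        exact absurd h.2 (not_le.mpr h'.1)
  have hN' : (N : ℝ) ≠ 0 := Nat.cast_ne_zero.mpr hN
  rw [h N, div_self hN']

/-- The coupling that moves the mass of the `i`-th cell to the `i`-th point. -/
theorem exists_isCoupling_le (hN : N ≠ 0)
    (hinj : Set.InjOn (fun i : ℕ => (α i : UnitAddCircle)) (Finset.range N))
    (hA : A = (Finset.range N).image fun i : ℕ => (α i : UnitAddCircle)) :
    ∃ π : Measure (UnitAddCircle × UnitAddCircle), IsCoupling π (empiricalMeasure A) volume ∧
      ∫⁻ z, edist z.1 z.2 ^ (2 : ℝ) ∂π ≤ ENNReal.ofReal (cellCost N α θ) := by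
  have hN' : (N : ℝ) ≠ 0 := Nat.cast_ne_zero.mpr hN
  set cell : ℕ → Set ℝ := fun i =>
    Set.Ioc (θ + (i : ℕ) / (N : ℝ)) (θ + ((i + 1 : ℕ) : ℝ) / (N : ℝ)) with hcell
  have hm : ∀ i : ℕ, Measurable fun y : ℝ => ((α i : UnitAddCircle), (y : UnitAddCircle)) :=
    fun i => measurable_const.prodMk AddCircle.measurable_mk'
  refine ⟨∑ i ∈ Finset.range N, ((volume : Measure ℝ).restrict (cell i)).map
    fun y : ℝ => ((α i : UnitAddCircle), (y : UnitAddCircle)), ⟨?_, ?_⟩, ?_⟩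
  · rw [Measure.map_finset_sum measurable_fst.aemeasurable, empiricalMeasure_eq hinj hA, Finset.smul_sum]
    refine Finset.sum_congr rfl fun i _ => ?_
    rw [Measure.map_map measurable_fst (hm i)]
    have : (Prod.fst ∘ fun y : ℝ => ((α i : UnitAddCircle), (y : UnitAddCircle)))
        = fun _ => (α i : UnitAddCircle) := rfl
    rw [this, Measure.map_const, Measure.restrict_apply_univ, hcell, Real.volume_Ioc]
    congr 1
    have : θ + ((i + 1 : ℕ) : ℝ) / N - (θ + (i : ℝ) / N) = (N : ℝ)⁻¹ := by
      push_cast; field_simp; ring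
    rw [this, ENNReal.ofReal_inv_of_pos (by positivity), ENNReal.ofReal_natCast]
  · rw [Measure.map_finset_sum measurable_snd.aemeasurable]
    have : ∀ i ∈ Finset.range N, Measure.map Prod.snd (((volume : Measure ℝ).restrict (cell i)).map
        fun y : ℝ => ((α i : UnitAddCircle), (y : UnitAddCircle)))
        = ((volume : Measure ℝ).restrict (cell i)).map ((↑) : ℝ → UnitAddCircle) := fun i _ => by
      rw [Measure.map_map measurable_snd (hm i)]
      rfl
    rw [Finset.sum_congr rfl this,
      ← Measure.map_finset_sum (AddCircle.measurable_mk').aemeasurable, hcell,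
      sum_restrict_cells hN]
    exact (UnitAddCircle.measurePreserving_mk θ).map_eq
  · rw [lintegral_finsetSum_measure, cellCost, ENNReal.ofReal_sum_of_nonneg
      (fun i _ => intervalIntegral.integral_nonneg (cell_le i) fun _ _ => sq_nonneg _)]
    refine Finset.sum_le_sum fun i _ => ?_
    have hmeas : Measurable fun z : UnitAddCircle × UnitAddCircle => edist z.1 z.2 ^ (2 : ℝ) :=
      measurable_edist.pow_const _
    rw [lintegral_map hmeas (hm i), intervalIntegral.integral_of_le (cell_le i),
      ofReal_integral_eq_lintegral_ofReal
        ((by fun_prop : Continuous fun y => (α i - y) ^ 2).integrableOn_Ioc)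
        (ae_of_all _ fun _ => sq_nonneg _)]
    refine lintegral_mono fun y => ?_
    rw [edist_dist, ENNReal.rpow_two, ← ENNReal.ofReal_pow dist_nonneg]
    refine ENNReal.ofReal_le_ofReal ?_
    rw [← sq_abs (α i - y)]
    exact pow_le_pow_left₀ dist_nonneg (dist_coe_le _ _) 2

theorem wassersteinDist_sq_eq_cellCost (hN : N ≠ 0) (hα : Monotone α)
    (hper : ∀ m, α (m + N) = α m + 1)
    (hθ : ∫ t in θ..θ + 1, (t - cellMap N α θ t) = 0)
    (hinj : Set.InjOn (fun i : ℕ => (α i : UnitAddCircle)) (Finset.range N))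
    (hA : A = (Finset.range N).image fun i : ℕ => (α i : UnitAddCircle)) :
    wassersteinDist 2 (empiricalMeasure A) volume ^ 2 = cellCost N α θ := by
  have hpos : 0 ≤ cellCost N α θ := Finset.sum_nonneg fun i _ =>
    intervalIntegral.integral_nonneg (cell_le i) fun _ _ => sq_nonneg _
  have : (⨅ (π : Measure (UnitAddCircle × UnitAddCircle))
      (_ : IsCoupling π (empiricalMeasure A) volume),
      (∫⁻ z, edist z.1 z.2 ^ (2 : ℝ) ∂π) ^ (1 / (2 : ℝ)))
      = ENNReal.ofReal (cellCost N α θ) ^ (1 / (2 : ℝ)) := by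
    apply le_antisymm
    · obtain ⟨π, hπ, hle⟩ := exists_isCoupling_le (θ := θ) hN hinj hA
      exact (iInf₂_le π hπ).trans (ENNReal.rpow_le_rpow hle (by norm_num))
    · exact le_iInf₂ fun π hπ => ENNReal.rpow_le_rpow
        (cellCost_le_of_isCoupling hN hα hper hθ hinj hA hπ) (by norm_num)
  rw [wassersteinDist, this, ← ENNReal.toReal_pow, ← ENNReal.rpow_two, ← ENNReal.rpow_mul]
  norm_num [hpos]

end Wasserstein

/-- In the sum of all distances of a sorted list, the coefficient of the `i`-th entry is twice the
number of entries before it minus the number of entries after it. -/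
theorem sum_sum_abs_sub_of_monotone {a : ℕ → ℝ} (ha : Monotone a) (N : ℕ) :
    ∑ i ∈ Finset.range N, ∑ j ∈ Finset.range N, |a i - a j|
      = 2 * ∑ i ∈ Finset.range N, (2 * (i : ℝ) + 1 - N) * a i := by
  induction N with
  | zero => simp
  | succ n ih =>
    have h1 : ∀ i ∈ Finset.range n, |a i - a n| = a n - a i := fun i hi => by
      have := ha (Finset.mem_range.mp hi).le
      rw [abs_of_nonpos (by linarith)]; ring
    have h2 : ∀ i ∈ Finset.range n, |a n - a i| = a n - a i := fun i hi => by
      rw [abs_sub_comm, h1 i hi]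
    have h3 : ∀ i : ℕ, (2 * (i : ℝ) + 1 - ((n + 1 : ℕ) : ℝ)) * a i
        = (2 * (i : ℝ) + 1 - n) * a i - a i := fun i => by push_cast; ring
    have h4 : ∀ i, ∑ j ∈ Finset.range (n + 1), |a i - a j|
        = ∑ j ∈ Finset.range n, |a i - a j| + |a i - a n| := fun i => Finset.sum_range_succ _ _
    simp_rw [h4]
    rw [Finset.sum_range_succ (fun i => ∑ j ∈ Finset.range n, |a i - a j| + |a i - a n|)]
    rw [Finset.sum_add_distrib, ih, Finset.sum_congr rfl h1, Finset.sum_congr rfl h2]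
    simp_rw [h3]
    rw [Finset.sum_range_succ]
    simp only [Finset.sum_sub_distrib, Finset.sum_const, Finset.card_range, nsmul_eq_mul, sub_self,
      abs_zero]
    ring

theorem sum_range_cast (N : ℕ) :
    ∑ i ∈ Finset.range N, (i : ℝ) = (N : ℝ) * (N - 1) / 2 := by
  induction N with
  | zero => simp
  | succ n ih => rw [Finset.sum_range_succ, ih]; push_cast; ring

theorem sum_range_cast_sq (N : ℕ) :
    ∑ i ∈ Finset.range N, (i : ℝ) ^ 2 = (N : ℝ) * (N - 1) * (2 * N - 1) / 6 := by
  induction N with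
  | zero => simp
  | succ n ih => rw [Finset.sum_range_succ, ih]; push_cast; ring

section CellCost

variable {N : ℕ} {α : ℤ → ℝ}

theorem integral_sub_cellMap (hN : N ≠ 0) (hα : Monotone α) (θ : ℝ) :
    ∫ t in θ..θ + 1, (t - cellMap N α θ t)
      = θ + 1 / 2 - (N : ℝ)⁻¹ * ∑ i ∈ Finset.range N, α i := by
  have hN' : (N : ℝ) ≠ 0 := Nat.cast_ne_zero.mpr hN
  have hS : ∫ t in θ..θ + 1, cellMap N α θ t = (N : ℝ)⁻¹ * ∑ i ∈ Finset.range N, α i := by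
    rw [← sum_integral_cells hN fun u v => (monotone_cellMap hα).intervalIntegrable,
      Finset.mul_sum]
    refine Finset.sum_congr rfl fun i _ => ?_
    have : ∫ y in (θ + (i : ℕ) / (N : ℝ))..(θ + ((i + 1 : ℕ) : ℝ) / (N : ℝ)), cellMap N α θ y
        = ∫ y in (θ + (i : ℕ) / (N : ℝ))..(θ + ((i + 1 : ℕ) : ℝ) / (N : ℝ)), α i := by
      refine intervalIntegral.integral_congr_ae ?_
      filter_upwards [Measure.ae_ne volume (θ + ((i + 1 : ℕ) : ℝ) / (N : ℝ))] with y hy1 hy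
      rw [Set.uIoc_of_le (cell_le i)] at hy
      exact cellMap_eq hN i ⟨hy.1.le, lt_of_le_of_ne hy.2 hy1⟩
    rw [this, intervalIntegral.integral_const, smul_eq_mul]
    push_cast
    field_simp
    ring
  rw [intervalIntegral.integral_sub (continuous_id'.intervalIntegrable _ _)
    (monotone_cellMap hα).intervalIntegrable, hS, integral_id]
  ring

theorem integral_sub_sq (c u v : ℝ) :
    ∫ y in u..v, (c - y) ^ 2 = ((c - u) ^ 3 - (c - v) ^ 3) / 3 := by
  rw [intervalIntegral.integral_comp_sub_left (fun y => y ^ 2), integral_pow]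
  norm_num

/-- For the balanced choice of `θ` the cost is half the Bernoulli pair energy divided by `N²`;
both sides are quadratic in `α`, the linear terms agreeing by `sum_sum_abs_sub_of_monotone`. -/
theorem cellCost_eq (hN : N ≠ 0) {θ : ℝ}
    (hθ : θ = (N : ℝ)⁻¹ * (∑ i ∈ Finset.range N, α i) - 1 / 2)
    (hα : Monotone α) :
    cellCost N α θ = 1 / (2 * (N : ℝ) ^ 2) * ∑ i ∈ Finset.range N, ∑ j ∈ Finset.range N,
      ((α i - α j) ^ 2 - |α i - α j| + 1 / 6) := by
  have hN' : (N : ℝ) ≠ 0 := Nat.cast_ne_zero.mpr hN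
  have habs := sum_sum_abs_sub_of_monotone (a := fun i : ℕ => α i)
    (fun i j h => hα (by exact_mod_cast h)) N
  have hcell : ∀ i : ℕ, ∫ y in (θ + (i : ℕ) / (N : ℝ))..(θ + ((i + 1 : ℕ) : ℝ) / (N : ℝ)),
      (α i - y) ^ 2 = (N : ℝ)⁻¹ * (α i ^ 2 - 2 * (N : ℝ)⁻¹ * (i * α i)
        - (2 * θ + (N : ℝ)⁻¹) * α i + (N : ℝ)⁻¹ ^ 2 * (i : ℝ) ^ 2
        + (N : ℝ)⁻¹ * (2 * θ + (N : ℝ)⁻¹) * i + (θ + (N : ℝ)⁻¹ / 2) ^ 2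
        + (N : ℝ)⁻¹ ^ 2 / 12) := fun i => by
    rw [integral_sub_sq]
    push_cast
    field_simp
    ring
  have hsq : ∀ i j : ℕ, (α i - α j) ^ 2 - |α i - α j| + 1 / 6
      = α i ^ 2 + α j ^ 2 - 2 * (α i * α j) - |α i - α j| + 1 / 6 := fun i j => by ring
  have hlin : ∀ i : ℕ, (2 * (i : ℝ) + 1 - N) * α i = 2 * (i * α i) + (1 - N) * α i :=
    fun i => by ring
  rw [cellCost]
  simp_rw [hcell, hsq]
  simp_rw [hlin] at habs
  simp only [Finset.sum_add_distrib, Finset.sum_sub_distrib, ← Finset.mul_sum, ← Finset.sum_mul,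
    Finset.sum_const, Finset.card_range, nsmul_eq_mul] at habs ⊢
  rw [habs, sum_range_cast, sum_range_cast_sq, hθ]
  -- What remains is an identity in the power sums of `α` and in `∑ i * α i`.
  generalize ∑ i ∈ Finset.range N, α (i : ℤ) = s1
  generalize ∑ i ∈ Finset.range N, α (i : ℤ) ^ 2 = s2
  generalize ∑ i ∈ Finset.range N, (i : ℝ) * α (i : ℤ) = s3
  field_simp
  ring

end CellCost

theorem exists_quasiperiodic_extension {N : ℕ} (hN : N ≠ 0) {a : Fin N → ℝ} (ha : StrictMono a)
    (ha01 : ∀ i, a i ∈ Set.Ico (0 : ℝ) 1) :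
    ∃ α : ℤ → ℝ, Monotone α ∧ (∀ m, α (m + N) = α m + 1) ∧ ∀ i : Fin N, α (i : ℕ) = a i := by
  have hpos : (0 : ℤ) < N := by exact_mod_cast Nat.pos_of_ne_zero hN
  have hlt : ∀ m : ℤ, (m % N).toNat < N := fun m => by
    have h1 := Int.emod_nonneg m hpos.ne'
    have h2 := Int.emod_lt_of_pos m hpos
    omega
  refine ⟨fun m => a ⟨(m % N).toNat, hlt m⟩ + ((m / N : ℤ) : ℝ), fun m m' h => ?_, fun m => ?_,
    fun i => ?_⟩
  · have hdiv : m / (N : ℤ) ≤ m' / N := Int.ediv_le_ediv hpos h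
    rcases hdiv.eq_or_lt with heq | hlt'
    · simp only [heq]
      gcongr
      apply ha.monotone
      rw [Fin.mk_le_mk]
      have h1 := Int.mul_ediv_add_emod m N
      have h2 := Int.mul_ediv_add_emod m' N
      rw [heq] at h1
      apply Int.toNat_le_toNat
      linarith
    -- In different periods the order comes from `a < 1` and `0 ≤ a`.
    · have h1 := (ha01 ⟨(m % N).toNat, hlt m⟩).2
      have h2 := (ha01 ⟨(m' % N).toNat, hlt m'⟩).1
      have h3 : ((m / N : ℤ) : ℝ) + 1 ≤ ((m' / N : ℤ) : ℝ) := by exact_mod_cast hlt'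
      simp only
      linarith
  · have h1 : (m + N) / (N : ℤ) = m / N + 1 := by
      rw [Int.add_ediv_of_dvd_right (dvd_refl _), Int.ediv_self hpos.ne']
    simp only [Int.add_emod_right, h1]
    push_cast
    ring
  · have h1 : ((i : ℕ) : ℤ) % N = (i : ℕ) := Int.emod_eq_of_lt (by positivity)
      (by exact_mod_cast i.2)
    have h2 : ((i : ℕ) : ℤ) / N = 0 := Int.ediv_eq_zero_of_lt (by positivity)
      (by exact_mod_cast i.2)
    simp only [h2, Int.cast_zero, add_zero]
    congr 1
    ext
    simp [h1]

theorem wassersteinDist_sq {A : Finset UnitAddCircle} {N : ℕ} (hN : N ≠ 0) (hcard : A.card = N) :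
    wassersteinDist 2 (empiricalMeasure A) volume ^ 2
      = 1 / (2 * (N : ℝ) ^ 2) * bernoulliEnergy A := by
  classical
  obtain ⟨a, hmono, ha, hinj, hA⟩ := exists_strictMono_lift hcard
  obtain ⟨α, hα, hper, hαa⟩ := exists_quasiperiodic_extension hN hmono ha
  have hinj' : Set.InjOn (fun i : ℕ => (α i : UnitAddCircle)) (Finset.range N) := by
    intro i hi j hj hij
    rw [Finset.mem_coe, Finset.mem_range] at hi hj
    have h1 := hαa ⟨i, hi⟩
    have h2 := hαa ⟨j, hj⟩
    simp only at h1 h2 hij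
    rw [h1, h2] at hij
    exact congrArg Fin.val (hinj hij)
  have hA' : A = (Finset.range N).image fun i : ℕ => (α i : UnitAddCircle) := by
    rw [hA]
    ext q
    simp only [Finset.mem_image, Finset.mem_univ, true_and, Finset.mem_range]
    constructor
    · rintro ⟨i, rfl⟩
      exact ⟨i, i.2, by rw [hαa]⟩
    · rintro ⟨i, hi, rfl⟩
      exact ⟨⟨i, hi⟩, by rw [← hαa]⟩
  rw [wassersteinDist_sq_eq_cellCost hN hα hper
    (θ := (N : ℝ)⁻¹ * (∑ i ∈ Finset.range N, α i) - 1 / 2) _ hinj' hA', cellCost_eq hN rfl hα,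
    bernoulliEnergy_eq ha hinj hA]
  · simp_rw [Finset.sum_range, hαa]
  · rw [integral_sub_cellMap hN hα]
    ring

/-! ### First and second moments of a determinantal process -/

theorem ncard_tuple_one {M : Type*} (A : Finset M) (B : Set M) :
    {x : Fin 1 → M | Function.Injective x ∧ (∀ i, x i ∈ A) ∧ x ∈ {x : Fin 1 → M | x 0 ∈ B}}.ncard
      = ((A : Set M) ∩ B).ncard := by
  symm
  refine Set.ncard_congr (fun p _ => fun _ => p) ?_ ?_ ?_
  · intro p hp
    exact ⟨Function.injective_of_subsingleton _, fun _ => hp.1, hp.2⟩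
  · intro p q _ _ h
    exact congrFun h 0
  · intro x hx
    refine ⟨x 0, ⟨hx.2.1 0, hx.2.2⟩, ?_⟩
    ext i
    rw [Subsingleton.elim i 0]

/-- The pairs of points of `A` in `B × C` are the pairs of distinct points and the diagonal ones.
-/
theorem ncard_tuple_two {M : Type*} (A : Finset M) (B C : Set M) :
    {x : Fin 2 → M | Function.Injective x ∧ (∀ i, x i ∈ A) ∧
      x ∈ {x : Fin 2 → M | x 0 ∈ B ∧ x 1 ∈ C}}.ncard + ((A : Set M) ∩ (B ∩ C)).ncard
      = ((A : Set M) ∩ B).ncard * ((A : Set M) ∩ C).ncard := by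
  classical
  set F : Finset (M × M) := A.filter (· ∈ B) ×ˢ A.filter (· ∈ C) with hF
  have hcoe : ∀ S : Set M, (A : Set M) ∩ S = ((A.filter (· ∈ S) : Finset M) : Set M) := by
    intro S; ext; simp
  have h1 : {x : Fin 2 → M | Function.Injective x ∧ (∀ i, x i ∈ A) ∧
      x ∈ {x : Fin 2 → M | x 0 ∈ B ∧ x 1 ∈ C}}.ncard = (F.filter fun z => ¬ z.1 = z.2).card := by
    rw [← Set.ncard_coe_finset]
    refine Set.ncard_congr (fun x _ => (x 0, x 1)) ?_ ?_ ?_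
    · rintro x ⟨hinj, hA, hB, hC⟩
      have : x 0 ≠ x 1 := fun h => by simpa using hinj h
      simp [hF, hA, hB, hC, this]
    · intro x y _ _ h
      simp only [Prod.mk.injEq] at h
      ext i
      fin_cases i
      · exact h.1
      · exact h.2
    · rintro ⟨p, q⟩ hz
      simp only [hF, Finset.coe_filter, Finset.mem_product, Finset.mem_filter,
        Set.mem_ofPred_eq] at hz
      refine ⟨![p, q], ⟨?_, ?_, ?_⟩, by simp⟩
      · intro i j hij
        fin_cases i <;> fin_cases j <;> simp_all
      · intro i
        fin_cases i
        · exact hz.1.1.1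
        · exact hz.1.2.1
      · exact ⟨hz.1.1.2, hz.1.2.2⟩
  have h2 : ((A : Set M) ∩ (B ∩ C)).ncard = (F.filter fun z => z.1 = z.2).card := by
    rw [hcoe, Set.ncard_coe_finset]
    refine Finset.card_bij (fun p _ => (p, p)) ?_ ?_ ?_
    · intro p hp
      simp only [Finset.mem_filter, Set.mem_inter_iff] at hp
      simp [hF, hp]
    · intro p _ q _ h
      exact congrArg Prod.fst h
    · rintro ⟨p, q⟩ hz
      simp only [hF, Finset.mem_product, Finset.mem_filter] at hz
      obtain ⟨⟨⟨hA, hB⟩, -, hC⟩, rfl⟩ := hz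
      exact ⟨p, by simp [hA, hB, hC], rfl⟩
  rw [h1, h2, hcoe B, hcoe C, Set.ncard_coe_finset, Set.ncard_coe_finset, ← Finset.card_product,
    add_comm]
  exact Finset.card_filter_add_card_filter_not _

section Counting

variable {M : Type*} [MeasurableSpace M]

/-- The counting measure `∑_{p ∈ A} δ_p` on a finite set `A` of points. -/
noncomputable def countingOn (A : Finset M) : Measure M := ∑ p ∈ A, Measure.dirac p

theorem countingOn_apply (A : Finset M) {B : Set M} (hB : MeasurableSet B) :
    countingOn A B = (((A : Set M) ∩ B).ncard : ℕ) := by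
  classical
  have h : (A : Set M) ∩ B = ((A.filter (· ∈ B) : Finset M) : Set M) := by ext; simp
  rw [h, Set.ncard_coe_finset, countingOn, Measure.finsetSum_apply, Finset.card_filter]
  push_cast
  refine Finset.sum_congr rfl fun p _ => ?_
  rw [Measure.dirac_apply' _ hB]
  simp [Set.indicator_apply]

instance (A : Finset M) : IsFiniteMeasure (countingOn A) :=
  ⟨by rw [countingOn_apply A MeasurableSet.univ]; exact ENNReal.natCast_lt_top _⟩

theorem integral_countingOn [MeasurableSingletonClass M] (A : Finset M) (f : M → ℝ) :
    ∫ p, f p ∂(countingOn A) = ∑ p ∈ A, f p := by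
  rw [countingOn, integral_finsetSum_measure fun i _ => integrable_dirac (by simp)]
  simp

theorem integral_prod_countingOn [MeasurableSingletonClass M] (A : Finset M) {f : M × M → ℝ}
    (hf : Integrable f ((countingOn A).prod (countingOn A))) :
    ∫ z, f z ∂((countingOn A).prod (countingOn A)) = ∑ p ∈ A, ∑ q ∈ A, f (p, q) := by
  rw [integral_prod f hf]
  simp_rw [integral_countingOn]

end Counting

section Determinantal

variable {M Ω : Type*} [MeasurableSpace M] [MeasurableSpace Ω] {K : M → M → ℂ} {ν : Measure M}
  [SigmaFinite ν] {P : Measure Ω} {X : Ω → Finset M}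

theorem lintegral_ncard_inter (h : IsDeterminantalProcess K ν P X) {B : Set M}
    (hB : MeasurableSet B) {N : ℕ} (hK : ∀ x, K x x = N) :
    ∫⁻ ω, (((X ω : Set M) ∩ B).ncard : ℝ≥0∞) ∂P = N * ν B := by
  have hm : MeasurableSet {x : Fin 1 → M | x 0 ∈ B} := measurable_pi_apply 0 hB
  have := h.joint_intensity 1 le_rfl _ hm
  simp_rw [ncard_tuple_one] at this
  rw [this]
  have hset : {x : Fin 1 → M | x 0 ∈ B} = Set.univ.pi fun _ => B := by
    ext x
    simp
  simp [hK, hset, Measure.pi_pi]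

theorem lintegral_ncard_mul_ncard (h : IsDeterminantalProcess K ν P X)
    {B C : Set M}
    (hB : MeasurableSet B) (hC : MeasurableSet C) {N : ℕ} (hK : ∀ x, K x x = N) :
    ∫⁻ ω, (((X ω : Set M) ∩ B).ncard : ℝ≥0∞) * ((X ω : Set M) ∩ C).ncard ∂P
      = ∫⁻ z in B ×ˢ C, ENNReal.ofReal ((N : ℂ) ^ 2 - K z.1 z.2 * K z.2 z.1).re ∂(ν.prod ν)
        + N * ν (B ∩ C) := by
  have hm : MeasurableSet {x : Fin 2 → M | x 0 ∈ B ∧ x 1 ∈ C} :=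
    (measurable_pi_apply 0 hB).inter (measurable_pi_apply 1 hC)
  have h2 := h.joint_intensity 2 one_le_two _ hm
  have hcast : ∀ ω, (((X ω : Set M) ∩ B).ncard : ℝ≥0∞) * ((X ω : Set M) ∩ C).ncard
      = ({x : Fin 2 → M | Function.Injective x ∧ (∀ i, x i ∈ X ω) ∧
        x ∈ {x : Fin 2 → M | x 0 ∈ B ∧ x 1 ∈ C}}.ncard : ℝ≥0∞)
        + ((X ω : Set M) ∩ (B ∩ C)).ncard := fun ω => by
    exact_mod_cast (ncard_tuple_two (X ω) B C).symm
  have hmeas : Measurable fun ω => (((X ω : Set M) ∩ (B ∩ C)).ncard : ℝ≥0∞) :=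
    (measurable_of_countable _).comp (h.measurable_count _ (hB.inter hC))
  simp_rw [hcast]
  rw [lintegral_add_right _ hmeas, h2, lintegral_ncard_inter h (hB.inter hC) hK]
  congr 1
  have hmp := measurePreserving_finTwoArrow ν
  have hpre : {x : Fin 2 → M | x 0 ∈ B ∧ x 1 ∈ C}
      = MeasurableEquiv.finTwoArrow ⁻¹' (B ×ˢ C) := rfl
  rw [hpre, ← hmp.setLIntegral_comp_preimage_emb MeasurableEquiv.finTwoArrow.measurableEmbedding]
  refine lintegral_congr fun x => ?_
  rw [Matrix.det_fin_two]
  simp [hK, sq]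

end Determinantal

section PairSum

open scoped ProbabilityTheory

variable {M Ω : Type*} [MeasurableSpace M] [MeasurableSpace Ω] {P : Measure Ω} {Y : Ω → Finset M}

theorem measurable_countingOn
    (hY : ∀ B : Set M, MeasurableSet B → Measurable fun ω => ((Y ω : Set M) ∩ B).ncard) :
    Measurable fun ω => countingOn (Y ω) := by
  refine Measure.measurable_of_measurable_coe _ fun B hB => ?_
  simp_rw [countingOn_apply _ hB]
  exact (measurable_of_countable _).comp (hY B hB)

/-- Campbell's formula for pairs: if the second moment measure of a random finite set of bounded
size is `μ₂`, the expectation of a sum over all pairs of points is an integral against `μ₂`. The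
second moment measure is given on rectangles only, where the counts are measurable by hypothesis;
the extension is made through the kernel `ω ↦ ∑_{p ∈ Y ω} δ_p`. -/
theorem integral_sum_sum_eq [MeasurableSingletonClass M] [IsFiniteMeasure P]
    (hY : ∀ B : Set M, MeasurableSet B → Measurable fun ω => ((Y ω : Set M) ∩ B).ncard)
    {N : ℕ} (hcard : ∀ ω, (Y ω).card ≤ N) {μ₂ : Measure (M × M)}
    (hμ₂ : ∀ B C : Set M, MeasurableSet B → MeasurableSet C →
      ∫⁻ ω, (((Y ω : Set M) ∩ B).ncard : ℝ≥0∞) * ((Y ω : Set M) ∩ C).ncard ∂P = μ₂ (B ×ˢ C))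
    {f : M × M → ℝ} (hf : Measurable f) {c : ℝ} (hc : ∀ z, ‖f z‖ ≤ c) :
    Integrable (fun ω => ∑ p ∈ Y ω, ∑ q ∈ Y ω, f (p, q)) P ∧
      ∫ ω, ∑ p ∈ Y ω, ∑ q ∈ Y ω, f (p, q) ∂P = ∫ z, f z ∂μ₂ := by
  set κ : ProbabilityTheory.Kernel Ω M := ⟨fun ω => countingOn (Y ω), measurable_countingOn hY⟩
    with hκ
  have hκω : ∀ ω, κ ω = countingOn (Y ω) := fun ω => rfl
  have hfin : ProbabilityTheory.IsFiniteKernel κ := by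
    refine ⟨⟨N, ENNReal.natCast_lt_top N, fun ω => ?_⟩⟩
    rw [hκω, countingOn_apply _ MeasurableSet.univ, Set.inter_univ, Set.ncard_coe_finset]
    exact_mod_cast hcard ω
  have hprod : ∀ ω, (κ ×ₖ κ) ω = (countingOn (Y ω)).prod (countingOn (Y ω)) := fun ω => by
    rw [ProbabilityTheory.Kernel.prod_apply, hκω]
  have hsecond : ((κ ×ₖ κ) ∘ₖ ProbabilityTheory.Kernel.const Unit P) () = μ₂ := by
    refine Measure.ext_prod fun {B C} hB hC => ?_
    rw [ProbabilityTheory.Kernel.comp_apply' _ _ _ (hB.prod hC),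
      ProbabilityTheory.Kernel.const_apply, ← hμ₂ B C hB hC]
    refine lintegral_congr fun ω => ?_
    rw [hprod, Measure.prod_prod, countingOn_apply _ hB, countingOn_apply _ hC]
  have hint : Integrable f (((κ ×ₖ κ) ∘ₖ ProbabilityTheory.Kernel.const Unit P) ()) :=
    Integrable.of_bound hf.aestronglyMeasurable c (ae_of_all _ hc)
  have hinner : ∀ ω, ∫ z, f z ∂((κ ×ₖ κ) ω) = ∑ p ∈ Y ω, ∑ q ∈ Y ω, f (p, q) := fun ω => by
    rw [hprod]
    exact integral_prod_countingOn _
      (Integrable.of_bound hf.aestronglyMeasurable c (ae_of_all _ hc))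
  have h1 := hint.integral_comp
  have h2 := ProbabilityTheory.Kernel.integral_comp hint
  rw [ProbabilityTheory.Kernel.const_apply] at h1 h2
  simp_rw [hinner] at h1 h2
  exact ⟨h1, by rw [← h2, hsecond]⟩

end PairSum

/-! ### The harmonic ensemble on the circle -/

/-- The Dirichlet kernel `D t = ∑_{|k| ≤ T} exp(2πikt)`, so that the harmonic kernel is `D (x -
y)`. -/
noncomputable def dirichletKernel (T : ℕ) (t : UnitAddCircle) : ℂ :=
  ∑ k ∈ Finset.Icc (-(T : ℤ)) (T : ℤ), fourier (T := (1 : ℝ)) k t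

theorem harmonicKernel_eq (T : ℕ) (x y : UnitAddCircle) :
    harmonicKernel T x y = dirichletKernel T (x - y) := rfl

theorem card_Icc_neg_self (T : ℕ) : (Finset.Icc (-(T : ℤ)) (T : ℤ)).card = 2 * T + 1 := by
  rw [Int.card_Icc]; omega

theorem harmonicKernel_self (T : ℕ) (x : UnitAddCircle) :
    harmonicKernel T x x = (2 * T + 1 : ℕ) := by
  rw [harmonicKernel, sub_self, ← card_Icc_neg_self]
  simp only [fourier_eval_zero, Finset.sum_const, nsmul_eq_mul, mul_one]

/-- The second joint intensity `N² - |D t|²` of the harmonic ensemble at two points of difference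
`t`, where `N = 2 T + 1`. The product `D t * D (-t)` is `|D t|²`. -/
noncomputable def pairDensity (T : ℕ) (t : UnitAddCircle) : ℝ :=
  (((2 * T + 1 : ℕ) : ℂ) ^ 2 - dirichletKernel T t * dirichletKernel T (-t)).re

theorem continuous_dirichletKernel (T : ℕ) : Continuous (dirichletKernel T) :=
  continuous_finsetSum _ fun k _ => (fourier k).continuous

theorem continuous_pairDensity (T : ℕ) : Continuous (pairDensity T) :=
  Complex.continuous_re.comp (continuous_const.sub
    ((continuous_dirichletKernel T).mul ((continuous_dirichletKernel T).comp continuous_neg)))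

theorem norm_dirichletKernel_le (T : ℕ) (t : UnitAddCircle) :
    ‖dirichletKernel T t‖ ≤ (2 * T + 1 : ℕ) := by
  refine (norm_sum_le _ _).trans ?_
  have : ∀ k ∈ Finset.Icc (-(T : ℤ)) (T : ℤ), ‖fourier (T := (1 : ℝ)) k t‖ = 1 :=
    fun k _ => Circle.norm_coe _
  rw [Finset.sum_congr rfl this, Finset.sum_const, card_Icc_neg_self]
  simp

theorem pairDensity_nonneg (T : ℕ) (t : UnitAddCircle) : 0 ≤ pairDensity T t := by
  have h : (dirichletKernel T t * dirichletKernel T (-t)).re ≤ ((2 * T + 1 : ℕ) : ℝ) ^ 2 := by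
    refine (Complex.re_le_norm _).trans ?_
    rw [norm_mul, sq]
    exact mul_le_mul (norm_dirichletKernel_le T t) (norm_dirichletKernel_le T _)
      (norm_nonneg _) (Nat.cast_nonneg _)
  have h2 : (((2 * T + 1 : ℕ) : ℂ) ^ 2).re = ((2 * T + 1 : ℕ) : ℝ) ^ 2 := by
    rw [← Complex.ofReal_natCast, ← Complex.ofReal_pow, Complex.ofReal_re]
  rw [pairDensity, Complex.sub_re, h2]
  linarith

theorem dirichletKernel_mul_neg (T : ℕ) (t : UnitAddCircle) :
    dirichletKernel T t * dirichletKernel T (-t)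
      = ∑ j ∈ Finset.Icc (-(T : ℤ)) (T : ℤ), ∑ l ∈ Finset.Icc (-(T : ℤ)) (T : ℤ),
        fourier (T := (1 : ℝ)) (j - l) t := by
  rw [dirichletKernel, dirichletKernel, Finset.sum_mul_sum]
  refine Finset.sum_congr rfl fun j _ => Finset.sum_congr rfl fun l _ => ?_
  rw [sub_eq_add_neg, fourier_add]
  congr 1
  rw [fourier_apply, fourier_apply, smul_neg, neg_smul]

theorem dirichletKernel_neg (T : ℕ) (t : UnitAddCircle) :
    dirichletKernel T (-t) = starRingEnd ℂ (dirichletKernel T t) := by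
  rw [dirichletKernel, dirichletKernel, map_sum]
  refine Finset.sum_congr rfl fun k _ => ?_
  rw [← fourier_neg, fourier_apply, fourier_apply, smul_neg, neg_smul]

theorem ofReal_pairDensity (T : ℕ) (t : UnitAddCircle) :
    (pairDensity T t : ℂ)
      = ((2 * T + 1 : ℕ) : ℂ) ^ 2 - dirichletKernel T t * dirichletKernel T (-t) := by
  rw [pairDensity, dirichletKernel_neg, Complex.mul_conj, ← Complex.ofReal_natCast,
    ← Complex.ofReal_pow, ← Complex.ofReal_sub, Complex.ofReal_re]

/-- Expanding `|D t|²` in frequencies `j - l` expresses the integral through the Fourier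
coefficients of `g`. -/
theorem integral_mul_pairDensity (T : ℕ) {g : UnitAddCircle → ℝ} (hg : Continuous g) :
    ((∫ t, g t * pairDensity T t : ℝ) : ℂ) = ((2 * T + 1 : ℕ) : ℂ) ^ 2 * (∫ t, g t : ℝ)
      - ∑ j ∈ Finset.Icc (-(T : ℤ)) (T : ℤ), ∑ l ∈ Finset.Icc (-(T : ℤ)) (T : ℤ),
        fourierCoeff (fun t => (g t : ℂ)) (l - j) := by
  have hgc : Continuous fun t => (g t : ℂ) := Complex.continuous_ofReal.comp hg
  have hint : ∀ {f : UnitAddCircle → ℂ}, Continuous f → Integrable f := fun hf =>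
    hf.integrable_of_hasCompactSupport (HasCompactSupport.of_compactSpace _)
  have hcoeff : ∀ j l : ℤ, fourierCoeff (fun t => (g t : ℂ)) (l - j)
      = ∫ t : UnitAddCircle, fourier (T := (1 : ℝ)) (j - l) t * (g t : ℂ) := fun j l => by
    rw [fourierCoeff, AddCircle.integral_haarAddCircle, neg_sub]
    simp
  have hF : ∀ j l : ℤ, Continuous fun t => fourier (T := (1 : ℝ)) (j - l) t * (g t : ℂ) :=
    fun j l => (fourier (j - l)).continuous.mul hgc
  have hpt : ∀ t, ((g t * pairDensity T t : ℝ) : ℂ) = ((2 * T + 1 : ℕ) : ℂ) ^ 2 * (g t : ℂ)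
      - ∑ j ∈ Finset.Icc (-(T : ℤ)) (T : ℤ), ∑ l ∈ Finset.Icc (-(T : ℤ)) (T : ℤ),
        fourier (T := (1 : ℝ)) (j - l) t * (g t : ℂ) := fun t => by
    rw [Complex.ofReal_mul, ofReal_pairDensity, dirichletKernel_mul_neg]
    simp_rw [← Finset.sum_mul]
    ring
  rw [← integral_complex_ofReal, ← integral_complex_ofReal]
  simp_rw [hpt]
  have hi : Continuous fun t => ((2 * T + 1 : ℕ) : ℂ) ^ 2 * (g t : ℂ) := continuous_const.mul hgc
  rw [integral_sub (hint hi) (hint (continuous_finsetSum _ fun j _ =>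
      continuous_finsetSum _ fun l _ => hF j l)), integral_const_mul,
    integral_finsetSum _ fun j _ => hint (continuous_finsetSum _ fun l _ => hF j l)]
  simp_rw [fun j => integral_finsetSum (Finset.Icc (-(T : ℤ)) (T : ℤ)) fun l _ => hint (hF j l),
    hcoeff]

theorem integral_pairDensity (T : ℕ) :
    ∫ t, pairDensity T t = ((2 * T + 1 : ℕ) : ℝ) ^ 2 - (2 * T + 1 : ℕ) := by
  have h := integral_mul_pairDensity T (g := fun _ => 1) continuous_const
  have h1 : ∀ m : ℤ, fourierCoeff (fun _ : UnitAddCircle => ((1 : ℝ) : ℂ)) m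
      = if m = 0 then 1 else 0 := fun m => by
    have : (fun _ : UnitAddCircle => ((1 : ℝ) : ℂ)) = fourier (T := (1 : ℝ)) 0 := by
      ext; simp
    rw [this, fourierCoeff_fourier, Pi.single_apply]
  simp_rw [h1, sub_eq_zero] at h
  simp only [one_mul, integral_const, Finset.sum_ite_eq'] at h
  rw [Finset.sum_congr rfl fun j hj => if_pos hj, Finset.sum_const, card_Icc_neg_self] at h
  have h2 : ((∫ t, pairDensity T t : ℝ) : ℂ)
      = ((((2 * T + 1 : ℕ) : ℝ) ^ 2 - (2 * T + 1 : ℕ) : ℝ) : ℂ) := by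
    rw [h]
    simp [Measure.real]
  exact_mod_cast h2

theorem integral_periodizedBernoulli_two : ∫ t, periodizedBernoulli 2 t = 0 := by
  have h := fourierCoeff_bernoulli_eq two_ne_zero 0
  rw [fourierCoeff, AddCircle.integral_haarAddCircle] at h
  simp only [neg_zero, fourier_zero, Function.comp_apply, one_smul, inv_one, Int.cast_zero,
    mul_zero, ne_eq, OfNat.ofNat_ne_zero, not_false_eq_true, zero_pow, div_zero,
    integral_complex_ofReal] at h
  exact_mod_cast h

theorem integral_periodizedBernoulli_two_mul_pairDensity (T : ℕ) :
    ∫ t, periodizedBernoulli 2 t * pairDensity T t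
      = -∑ j ∈ Finset.Icc (-(T : ℤ)) (T : ℤ), ∑ l ∈ Finset.Icc (-(T : ℤ)) (T : ℤ),
        1 / (2 * Real.pi ^ 2 * ((l - j : ℤ) : ℝ) ^ 2) := by
  have h := integral_mul_pairDensity T (periodizedBernoulli.continuous (k := 2) (by norm_num))
  have h1 : ∀ m : ℤ, fourierCoeff (fun t => (periodizedBernoulli 2 t : ℂ)) m
      = ((1 / (2 * Real.pi ^ 2 * (m : ℝ) ^ 2) : ℝ) : ℂ) := fun m => by
    have := fourierCoeff_bernoulli_eq two_ne_zero m
    refine this.trans ?_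
    push_cast
    rw [mul_pow, mul_pow, mul_pow, Complex.I_sq]
    rcases eq_or_ne m 0 with rfl | hm
    · simp
    · have : (m : ℂ) ≠ 0 := Int.cast_ne_zero.mpr hm
      have hpi : (Real.pi : ℂ) ≠ 0 := Complex.ofReal_ne_zero.mpr Real.pi_ne_zero
      rw [Nat.factorial_two]
      push_cast
      field_simp
  simp_rw [h1] at h
  rw [integral_periodizedBernoulli_two] at h
  have h2 : ((∫ t, periodizedBernoulli 2 t * pairDensity T t : ℝ) : ℂ)
      = ((-∑ j ∈ Finset.Icc (-(T : ℤ)) (T : ℤ), ∑ l ∈ Finset.Icc (-(T : ℤ)) (T : ℤ),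
        1 / (2 * Real.pi ^ 2 * ((l - j : ℤ) : ℝ) ^ 2) : ℝ) : ℂ) := by
    rw [h]
    push_cast
    ring
  exact_mod_cast h2

theorem integral_prod_sub {G : UnitAddCircle → ℝ} (hG : Continuous G) :
    ∫ z : UnitAddCircle × UnitAddCircle, G (z.1 - z.2) = ∫ t, G t := by
  have hc : Continuous fun z : UnitAddCircle × UnitAddCircle => G (z.1 - z.2) := by fun_prop
  have hi : Integrable (fun z : UnitAddCircle × UnitAddCircle => G (z.1 - z.2))
      ((volume : Measure UnitAddCircle).prod volume) :=
    hc.integrable_of_hasCompactSupport (HasCompactSupport.of_compactSpace _)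
  rw [Measure.volume_eq_prod, integral_prod _ hi]
  simp_rw [integral_sub_left_eq_self G]
  simp [Measure.real]

/-- The second moment measure of the harmonic ensemble: pairs of distinct points contribute the
second joint intensity, and the diagonal contributes the first one, which is the constant `2 T +
1`. -/
noncomputable def harmonicSecondMoment (T : ℕ) : Measure (UnitAddCircle × UnitAddCircle) :=
  (volume.prod volume).withDensity (fun z => ENNReal.ofReal (pairDensity T (z.1 - z.2)))
    + ((2 * T + 1 : ℕ) : ℝ≥0∞) • (volume : Measure UnitAddCircle).map fun x => (x, x)

instance (T : ℕ) : IsFiniteMeasure (harmonicSecondMoment T) := by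
  have hρ := continuous_pairDensity T
  have hρ2 : Continuous fun z : UnitAddCircle × UnitAddCircle => pairDensity T (z.1 - z.2) := by
    fun_prop
  have h1 := isFiniteMeasure_withDensity_ofReal
      (μ := (volume.prod volume : Measure (UnitAddCircle × UnitAddCircle)))
      (hρ2.integrable_of_hasCompactSupport (HasCompactSupport.of_compactSpace _)).2
  have h2 : IsFiniteMeasure (((2 * T + 1 : ℕ) : ℝ≥0∞) •
      (volume : Measure UnitAddCircle).map fun x => (x, x)) :=
    Measure.smul_finite _ (ENNReal.natCast_ne_top _)
  rw [harmonicSecondMoment]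
  infer_instance

theorem integral_harmonicSecondMoment (T : ℕ) {f : UnitAddCircle → ℝ} (hf : Continuous f) :
    ∫ z, f (z.1 - z.2) ∂(harmonicSecondMoment T)
      = (∫ t, f t * pairDensity T t) + (2 * T + 1 : ℕ) * f 0 := by
  have hc : Continuous fun z : UnitAddCircle × UnitAddCircle => f (z.1 - z.2) := by fun_prop
  have hρ := continuous_pairDensity T
  have hρ2 : Continuous fun z : UnitAddCircle × UnitAddCircle => pairDensity T (z.1 - z.2) := by
    fun_prop
  have hd : Measurable fun x : UnitAddCircle => (x, x) := by fun_prop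
  have hfin : IsFiniteMeasure ((volume.prod volume : Measure (UnitAddCircle × UnitAddCircle)
      ).withDensity (fun z => ENNReal.ofReal (pairDensity T (z.1 - z.2)))) :=
    isFiniteMeasure_withDensity_ofReal
      (hρ2.integrable_of_hasCompactSupport (HasCompactSupport.of_compactSpace _)).2
  rw [harmonicSecondMoment, integral_add_measure
    (hc.integrable_of_hasCompactSupport (HasCompactSupport.of_compactSpace _))
    ((hc.integrable_of_hasCompactSupport (HasCompactSupport.of_compactSpace _)).smul_measure
      (ENNReal.natCast_ne_top _)),
    integral_smul_measure, integral_map hd.aemeasurable hc.aestronglyMeasurable,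
    integral_withDensity_eq_integral_toReal_smul (by fun_prop) (by simp)]
  congr 1
  · rw [← integral_prod_sub (G := fun t => f t * pairDensity T t) (hf.mul hρ), ← Measure.volume_eq_prod]
    refine integral_congr_ae (ae_of_all _ fun z => ?_)
    simp only [smul_eq_mul]
    rw [ENNReal.toReal_ofReal (pairDensity_nonneg T _), mul_comm]
  · rw [ENNReal.toReal_natCast]
    simp [Measure.real]

section HarmonicEnsemble

variable {Ω : Type*} [MeasurableSpace Ω] {T : ℕ} {P : Measure Ω} {X : Ω → Finset UnitAddCircle}

theorem lintegral_ncard_mul_ncard_harmonic (h : IsHarmonicEnsemble T P X)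
    {B C : Set UnitAddCircle} (hB : MeasurableSet B) (hC : MeasurableSet C) :
    ∫⁻ ω, (((X ω : Set UnitAddCircle) ∩ B).ncard : ℝ≥0∞)
      * ((X ω : Set UnitAddCircle) ∩ C).ncard ∂P = harmonicSecondMoment T (B ×ˢ C) := by
  have hd : Measurable fun x : UnitAddCircle => (x, x) := by fun_prop
  rw [lintegral_ncard_mul_ncard h hB hC (harmonicKernel_self T), harmonicSecondMoment,
    Measure.add_apply, withDensity_apply _ (hB.prod hC), Measure.smul_apply,
    Measure.map_apply hd (hB.prod hC)]
  congr 1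
  refine lintegral_congr fun z => ?_
  rw [harmonicKernel_eq, harmonicKernel_eq, pairDensity, neg_sub]

theorem measurable_card_harmonic (h : IsHarmonicEnsemble T P X) :
    Measurable fun ω => (X ω).card := by
  simpa using h.measurable_count Set.univ MeasurableSet.univ

/-- The number of points has mean `N` and second moment `N²`, hence variance zero. -/
theorem card_harmonicEnsemble [IsProbabilityMeasure P] (h : IsHarmonicEnsemble T P X) :
    ∀ᵐ ω ∂P, (X ω).card = 2 * T + 1 := by
  set N : ℕ := 2 * T + 1 with hN
  have hm := measurable_card_harmonic h
  have hmR : Measurable fun ω => ((X ω).card : ℝ) := (measurable_of_countable _).comp hm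
  have h1 : ∫⁻ ω, ENNReal.ofReal ((X ω).card : ℝ) ∂P = N := by
    have := lintegral_ncard_inter h MeasurableSet.univ (harmonicKernel_self T)
    simpa [hN] using this
  have h2 : ∫⁻ ω, ENNReal.ofReal (((X ω).card : ℝ) ^ 2) ∂P
      = harmonicSecondMoment T Set.univ := by
    have := lintegral_ncard_mul_ncard_harmonic h MeasurableSet.univ MeasurableSet.univ
    rw [Set.univ_prod_univ] at this
    rw [← this]
    refine lintegral_congr fun ω => ?_
    rw [ENNReal.ofReal_pow (Nat.cast_nonneg _), ENNReal.ofReal_natCast, Set.inter_univ,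
      Set.ncard_coe_finset, sq]
  have hval : (harmonicSecondMoment T Set.univ).toReal = (N : ℝ) ^ 2 := by
    have := integral_harmonicSecondMoment T (f := fun _ => 1) continuous_const
    simp only [integral_const, smul_eq_mul, mul_one, one_mul, integral_pairDensity] at this
    rw [← Measure.real, this]
    ring
  have hn1 : ∀ᵐ ω ∂P, 0 ≤ ((X ω).card : ℝ) := ae_of_all _ fun ω => Nat.cast_nonneg _
  have hn2 : ∀ᵐ ω ∂P, 0 ≤ ((X ω).card : ℝ) ^ 2 := ae_of_all _ fun ω => sq_nonneg _
  have i1 : Integrable (fun ω => ((X ω).card : ℝ)) P := by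
    refine ⟨hmR.aestronglyMeasurable, ?_⟩
    rw [hasFiniteIntegral_iff_ofReal hn1, h1]
    exact ENNReal.natCast_lt_top _
  have i2 : Integrable (fun ω => ((X ω).card : ℝ) ^ 2) P := by
    refine ⟨(hmR.pow_const 2).aestronglyMeasurable, ?_⟩
    rw [hasFiniteIntegral_iff_ofReal hn2, h2]
    exact measure_lt_top _ _
  have e1 : ∫ ω, ((X ω).card : ℝ) ∂P = N := by
    rw [integral_eq_lintegral_of_nonneg_ae hn1 hmR.aestronglyMeasurable, h1,
      ENNReal.toReal_natCast]
  have e2 : ∫ ω, ((X ω).card : ℝ) ^ 2 ∂P = (N : ℝ) ^ 2 := by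
    rw [integral_eq_lintegral_of_nonneg_ae hn2 (hmR.pow_const 2).aestronglyMeasurable, h2, hval]
  have hexp : ∀ ω, (((X ω).card : ℝ) - N) ^ 2
      = ((X ω).card : ℝ) ^ 2 + ((-2 * (N : ℝ)) * (X ω).card + (N : ℝ) ^ 2) := fun ω => by ring
  have hlin : Integrable (fun ω => (-2 * (N : ℝ)) * (X ω).card + (N : ℝ) ^ 2) P := (i1.const_mul (-2 * (N : ℝ))).add
    (integrable_const _)
  have i3 : Integrable (fun ω => (((X ω).card : ℝ) - N) ^ 2) P := by
    simp_rw [hexp]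
    exact i2.add hlin
  have e3 : ∫ ω, (((X ω).card : ℝ) - N) ^ 2 ∂P = 0 := by
    simp_rw [hexp]
    rw [integral_add i2 hlin, integral_add (i1.const_mul _) (integrable_const _),
      integral_const_mul, e1, e2]
    simp
    ring
  have h0 := (integral_eq_zero_iff_of_nonneg (fun ω => sq_nonneg _) i3).mp e3
  filter_upwards [h0] with ω hω
  have : ((X ω).card : ℝ) - N = 0 := by simpa using hω
  exact_mod_cast sub_eq_zero.mp this

theorem integral_bernoulliEnergy [IsProbabilityMeasure P] (h : IsHarmonicEnsemble T P X) :
    Integrable (fun ω => bernoulliEnergy (X ω)) P ∧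
      ∫ ω, bernoulliEnergy (X ω) ∂P = (2 * T + 1 : ℕ) / 6
        - ∑ j ∈ Finset.Icc (-(T : ℤ)) (T : ℤ), ∑ l ∈ Finset.Icc (-(T : ℤ)) (T : ℤ),
          1 / (2 * Real.pi ^ 2 * ((l - j : ℤ) : ℝ) ^ 2) := by
  classical
  -- Discarding the null set where the number of points is wrong makes the counts bounded.
  set Y : Ω → Finset UnitAddCircle := fun ω => if (X ω).card = 2 * T + 1 then X ω else ∅ with hY
  have hYX : ∀ᵐ ω ∂P, Y ω = X ω := by
    filter_upwards [card_harmonicEnsemble h] with ω hω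
    exact if_pos hω
  have hYcard : ∀ ω, (Y ω).card ≤ 2 * T + 1 := fun ω => by
    simp only [hY]
    split_ifs with hc
    · exact hc.le
    · simp
  have hYm : ∀ B : Set UnitAddCircle, MeasurableSet B →
      Measurable fun ω => ((Y ω : Set UnitAddCircle) ∩ B).ncard := fun B hB => by
    have : (fun ω => ((Y ω : Set UnitAddCircle) ∩ B).ncard)
        = fun ω => if (X ω).card = 2 * T + 1 then ((X ω : Set UnitAddCircle) ∩ B).ncard else 0 := by
      ext ω
      simp only [hY]
      split_ifs <;> simp
    rw [this]
    exact Measurable.ite (measurable_card_harmonic h (measurableSet_singleton _))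
      (h.measurable_count B hB) measurable_const
  have hμ₂ : ∀ B C : Set UnitAddCircle, MeasurableSet B → MeasurableSet C →
      ∫⁻ ω, (((Y ω : Set UnitAddCircle) ∩ B).ncard : ℝ≥0∞)
        * ((Y ω : Set UnitAddCircle) ∩ C).ncard ∂P = harmonicSecondMoment T (B ×ˢ C) :=
    fun B C hB hC => by
      rw [← lintegral_ncard_mul_ncard_harmonic h hB hC]
      refine lintegral_congr_ae ?_
      filter_upwards [hYX] with ω hω
      rw [hω]
  have hβ := periodizedBernoulli.continuous (k := 2) (by norm_num)
  have hf : Continuous fun z : UnitAddCircle × UnitAddCircle =>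
      periodizedBernoulli 2 (z.1 - z.2) := hβ.comp (continuous_fst.sub continuous_snd)
  obtain ⟨c, hc⟩ := (HasCompactSupport.of_compactSpace
    (fun z : UnitAddCircle × UnitAddCircle => periodizedBernoulli 2 (z.1 - z.2))
    ).exists_bound_of_continuous hf
  obtain ⟨hint, hval⟩ := integral_sum_sum_eq hYm hYcard hμ₂ hf.measurable hc
  have hae : (fun ω => ∑ p ∈ Y ω, ∑ q ∈ Y ω, periodizedBernoulli 2 (p - q))
      =ᵐ[P] fun ω => bernoulliEnergy (X ω) := by
    filter_upwards [hYX] with ω hω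
    rw [hω, bernoulliEnergy]
  refine ⟨hint.congr hae, ?_⟩
  have h0 : periodizedBernoulli 2 0 = 1 / 6 := by
    simpa using periodizedBernoulli_two_sub (a := 0) (b := 0) (by simp) (by simp)
  rw [← integral_congr_ae hae, hval, integral_harmonicSecondMoment T hβ,
    integral_periodizedBernoulli_two_mul_pairDensity, h0]
  ring

end HarmonicEnsemble

/-! ### The expectation as an explicit sum -/

theorem sum_Icc_one_eq_sum_range (f : ℕ → ℝ) (N : ℕ) :
    ∑ k ∈ Finset.Icc 1 N, f k = ∑ i ∈ Finset.range N, f (i + 1) := by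
  induction N with
  | zero => simp
  | succ n ih => rw [Finset.sum_Icc_succ_top (by omega), ih, Finset.sum_range_succ]

/-- The difference `m > 0` occurs `N - m` times among ordered pairs. The diagonal terms are `1 / 0
= 0`. -/
theorem sum_sum_one_div_sq_sub (N : ℕ) :
    ∑ i ∈ Finset.range N, ∑ j ∈ Finset.range N, 1 / ((i : ℝ) - j) ^ 2
      = 2 * (N * (∑ k ∈ Finset.Icc 1 N, 1 / (k : ℝ) ^ 2) - ∑ k ∈ Finset.Icc 1 N, 1 / (k : ℝ)) := by
  induction N with
  | zero => simp
  | succ n ih =>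
    have h1 : ∀ i, ∑ j ∈ Finset.range (n + 1), 1 / ((i : ℝ) - j) ^ 2
        = ∑ j ∈ Finset.range n, 1 / ((i : ℝ) - j) ^ 2 + 1 / ((i : ℝ) - n) ^ 2 :=
      fun i => Finset.sum_range_succ _ _
    have h2 : ∑ i ∈ Finset.range n, 1 / ((n : ℝ) - i) ^ 2
        = ∑ k ∈ Finset.Icc 1 n, 1 / (k : ℝ) ^ 2 := by
      rw [← Finset.sum_range_reflect, sum_Icc_one_eq_sum_range]
      refine Finset.sum_congr rfl fun i hi => ?_
      have := Finset.mem_range.mp hi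
      rw [Nat.sub_sub, Nat.cast_sub (by omega)]
      push_cast
      ring_nf
    have h3 : ∑ i ∈ Finset.range n, 1 / ((i : ℝ) - n) ^ 2
        = ∑ k ∈ Finset.Icc 1 n, 1 / (k : ℝ) ^ 2 := by
      rw [← h2]
      refine Finset.sum_congr rfl fun i _ => ?_
      rw [← neg_sub, neg_sq]
    simp_rw [h1]
    rw [Finset.sum_range_succ (fun i => ∑ j ∈ Finset.range n, 1 / ((i : ℝ) - j) ^ 2
      + 1 / ((i : ℝ) - n) ^ 2), Finset.sum_add_distrib, ih, h2, h3,
      Finset.sum_Icc_succ_top (by omega), Finset.sum_Icc_succ_top (by omega)]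
    have : (n : ℝ) + 1 ≠ 0 := by positivity
    push_cast
    field_simp
    simp
    ring

/-- Reindexing of the frequencies `-T, …, T` by `0, …, 2 T`. -/
theorem sum_Icc_neg_self {β : Type*} [AddCommMonoid β] (T : ℕ) (f : ℤ → β) :
    ∑ j ∈ Finset.Icc (-(T : ℤ)) (T : ℤ), f j
      = ∑ i ∈ Finset.range (2 * T + 1), f ((i : ℤ) - T) := by
  symm
  refine Finset.sum_bij (fun i _ => (i : ℤ) - T) ?_ ?_ ?_ ?_
  · intro i hi
    rw [Finset.mem_range] at hi
    rw [Finset.mem_Icc]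
    omega
  · intro i _ j _ h
    omega
  · intro m hm
    rw [Finset.mem_Icc] at hm
    exact ⟨(m + T).toNat, Finset.mem_range.mpr (by omega), by omega⟩
  · intro i _
    rfl

theorem sum_add_tail_eq_zeta_two (N : ℕ) :
    ∑ k ∈ Finset.Icc 1 N, 1 / (k : ℝ) ^ 2 + ∑' j : ℕ, 1 / ((N : ℝ) + 1 + (j : ℝ)) ^ 2
      = Real.pi ^ 2 / 6 := by
  have h := hasSum_zeta_two.summable.sum_add_tsum_nat_add (N + 1)
  rw [hasSum_zeta_two.tsum_eq, Finset.sum_range_succ'] at h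
  rw [← h]
  congr 1
  · simp [sum_Icc_one_eq_sum_range]
  · refine tsum_congr fun j => ?_
    push_cast
    ring_nf

theorem sum_sum_fourier_weights (T N : ℕ) (hN : N = 2 * T + 1) :
    ∑ j ∈ Finset.Icc (-(T : ℤ)) (T : ℤ), ∑ l ∈ Finset.Icc (-(T : ℤ)) (T : ℤ),
      1 / (2 * Real.pi ^ 2 * ((l - j : ℤ) : ℝ) ^ 2)
      = 1 / Real.pi ^ 2 * (N * (∑ k ∈ Finset.Icc 1 N, 1 / (k : ℝ) ^ 2)
        - ∑ k ∈ Finset.Icc 1 N, 1 / (k : ℝ)) := by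
  have h : ∀ i j : ℕ, 1 / (2 * Real.pi ^ 2 * ((((i : ℤ) - T) - ((j : ℤ) - T) : ℤ) : ℝ) ^ 2)
      = 1 / (2 * Real.pi ^ 2) * (1 / ((i : ℝ) - j) ^ 2) := fun i j => by
    rw [one_div_mul_one_div]
    congr 3
    push_cast
    ring
  rw [Finset.sum_comm]
  simp_rw [sum_Icc_neg_self, h, ← Finset.mul_sum]
  rw [← hN, sum_sum_one_div_sq_sub]
  field_simp

/-! ### Asymptotics of the explicit sum -/

theorem hasSum_telescoping {x : ℝ} (hx : 0 < x) :
    HasSum (fun j : ℕ => 1 / ((x + j) * (x + j + 1))) (1 / x) := by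
  rw [hasSum_iff_tendsto_nat_of_nonneg (fun j => by positivity)]
  have hsum : ∀ n : ℕ, ∑ j ∈ Finset.range n, 1 / ((x + j) * (x + j + 1)) = 1 / x - 1 / (x + n) := by
    intro n
    induction n with
    | zero => simp
    | succ n ih =>
      rw [Finset.sum_range_succ, ih]
      have h1 : x + (n : ℝ) ≠ 0 := by positivity
      have h2 : x + (n : ℝ) + 1 ≠ 0 := by positivity
      have h3 : x + ((n + 1 : ℕ) : ℝ) = x + n + 1 := by push_cast; ring
      rw [h3]
      field_simp
      ring
  simp_rw [hsum]
  have : Tendsto (fun n : ℕ => 1 / (x + n)) atTop (𝓝 0) := by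
    simp_rw [one_div]
    exact tendsto_inv_atTop_zero.comp
      (tendsto_atTop_add_const_left _ _ tendsto_natCast_atTop_atTop)
  simpa using this.const_sub (1 / x)

theorem tail_bounds {N : ℕ} (hN : N ≠ 0) :
    1 / ((N : ℝ) + 1) ≤ ∑' j : ℕ, 1 / ((N : ℝ) + 1 + (j : ℝ)) ^ 2 ∧
      ∑' j : ℕ, 1 / ((N : ℝ) + 1 + (j : ℝ)) ^ 2 ≤ 1 / (N : ℝ) := by
  have hN' : (0 : ℝ) < N := by positivity
  have hl := hasSum_telescoping (x := (N : ℝ) + 1) (by positivity)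
  have hu := hasSum_telescoping hN'
  have hle : ∀ j : ℕ, 1 / ((N : ℝ) + 1 + (j : ℝ)) ^ 2 ≤ 1 / (((N : ℝ) + j) * (N + j + 1)) :=
    fun j => by
      refine one_div_le_one_div_of_le (by positivity) ?_
      have : (0 : ℝ) ≤ j := Nat.cast_nonneg j
      nlinarith
  have hge : ∀ j : ℕ, 1 / (((N : ℝ) + 1 + j) * (N + 1 + j + 1)) ≤ 1 / ((N : ℝ) + 1 + (j : ℝ)) ^ 2 :=
    fun j => by
      refine one_div_le_one_div_of_le (by positivity) ?_
      have : (0 : ℝ) ≤ j := Nat.cast_nonneg j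
      nlinarith
  have hs : Summable fun j : ℕ => 1 / ((N : ℝ) + 1 + (j : ℝ)) ^ 2 :=
    Summable.of_nonneg_of_le (fun j => by positivity) hle hu.summable
  exact ⟨hasSum_le hge hl hs.hasSum, hasSum_le hle hs.hasSum hu⟩

/-- The explicit value of the expected squared Wasserstein distance, as a function of the number
`N` of points. -/
noncomputable def expectedCost (N : ℕ) : ℝ :=
  1 / (2 * Real.pi ^ 2 * (N : ℝ) ^ 2) * ∑ k ∈ Finset.Icc 1 N, 1 / (k : ℝ)
    + 1 / (2 * Real.pi ^ 2 * (N : ℝ)) * ∑' j : ℕ, 1 / ((N : ℝ) + 1 + (j : ℝ)) ^ 2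

/-- The error in `2π²N² · expectedCost N ≈ log N + γ + 1`: the errors of the harmonic sum and of
the tail of `ζ(2)`. -/
noncomputable def costRemainder (N : ℕ) : ℝ :=
  (∑ k ∈ Finset.Icc 1 N, 1 / (k : ℝ)) - Real.log N - Real.eulerMascheroniConstant
    + (N * (∑' j : ℕ, 1 / ((N : ℝ) + 1 + (j : ℝ)) ^ 2) - 1)

theorem expectedCost_eq {N : ℕ} (hN : N ≠ 0) :
    expectedCost N = (Real.log N + Real.eulerMascheroniConstant + 1 + costRemainder N)
      / (2 * Real.pi ^ 2 * (N : ℝ) ^ 2) := by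
  have hN' : (N : ℝ) ≠ 0 := Nat.cast_ne_zero.mpr hN
  rw [expectedCost, costRemainder]
  field_simp
  ring

theorem abs_costRemainder_le {N : ℕ} (hN : N ≠ 0) : |costRemainder N| ≤ 1 / N := by
  have hN' : (0 : ℝ) < N := by positivity
  have h1 := Real.eulerMascheroniSeq_lt_eulerMascheroniConstant N
  have h2 := Real.eulerMascheroniConstant_lt_eulerMascheroniSeq' N
  have hH : ((harmonic N : ℚ) : ℝ) = ∑ k ∈ Finset.Icc 1 N, 1 / (k : ℝ) := by
    rw [harmonic_eq_sum_Icc]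
    push_cast
    simp_rw [one_div]
  rw [Real.eulerMascheroniSeq, hH] at h1
  rw [Real.eulerMascheroniSeq', if_neg hN, hH] at h2
  have hlog : Real.log (N + 1) - Real.log N ≤ 1 / N := by
    rw [← Real.log_div (by positivity) hN'.ne']
    refine (Real.log_le_sub_one_of_pos (by positivity)).trans_eq ?_
    field_simp
    ring
  obtain ⟨h3, h4⟩ := tail_bounds hN
  have h3' := mul_le_mul_of_nonneg_left h3 hN'.le
  have h4' := mul_le_mul_of_nonneg_left h4 hN'.le
  rw [mul_one_div_cancel hN'.ne'] at h4'
  have h5 : 1 - 1 / (N : ℝ) ≤ N * (1 / ((N : ℝ) + 1)) := by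
    rw [← sub_nonneg]
    have : (N : ℝ) * (1 / ((N : ℝ) + 1)) - (1 - 1 / (N : ℝ)) = 1 / (N * (N + 1)) := by
      field_simp
      ring
    rw [this]
    positivity
  rw [costRemainder, abs_le]
  constructor <;> linarith

theorem abs_expectedCost_sub_le {N : ℕ} (hN : N ≠ 0) :
    |expectedCost N - (Real.log N + Real.eulerMascheroniConstant + 1)
      / (2 * Real.pi ^ 2 * (N : ℝ) ^ 2)| ≤ 1 / (N : ℝ) ^ 3 := by
  have hN' : (0 : ℝ) < N := by positivity
  have h := abs_costRemainder_le hN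
  have hpi : 1 ≤ 2 * Real.pi ^ 2 := by nlinarith [Real.pi_gt_three]
  rw [expectedCost_eq hN, ← sub_div, add_sub_cancel_left, abs_div,
    abs_of_pos (show 0 < 2 * Real.pi ^ 2 * (N : ℝ) ^ 2 by positivity)]
  calc |costRemainder N| / (2 * Real.pi ^ 2 * (N : ℝ) ^ 2)
      ≤ (1 / N) / (1 * (N : ℝ) ^ 2) := by gcongr
    _ = 1 / (N : ℝ) ^ 3 := by field_simp

theorem isEquivalent_sqrt_expectedCost :
    Asymptotics.IsEquivalent atTop (fun N : ℕ => Real.sqrt (expectedCost N))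
      (fun N : ℕ => Real.sqrt (Real.log N) / (Real.sqrt 2 * Real.pi * N)) := by
  have hlog : Tendsto (fun N : ℕ => Real.log N) atTop atTop :=
    Real.tendsto_log_atTop.comp tendsto_natCast_atTop_atTop
  have hlim : Tendsto (fun N : ℕ => 1 + (Real.eulerMascheroniConstant + 1 + costRemainder N)
      / Real.log N) atTop (𝓝 1) := by
    have hrem : Tendsto costRemainder atTop (𝓝 0) := by
      refine squeeze_zero_norm' ?_ tendsto_one_div_atTop_nhds_zero_nat
      filter_upwards [eventually_ne_atTop 0] with N hN
      exact abs_costRemainder_le hN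
    simpa using ((hrem.const_add (Real.eulerMascheroniConstant + 1)).div_atTop hlog).const_add 1
  have hsqrt := (Real.continuous_sqrt.tendsto 1).comp hlim
  rw [Real.sqrt_one] at hsqrt
  have hpos : ∀ᶠ N : ℕ in atTop, 0 < Real.log N := hlog.eventually_gt_atTop 0
  refine Asymptotics.isEquivalent_of_tendsto_one (hsqrt.congr' ?_)
  filter_upwards [hpos, eventually_ne_atTop 0] with N hN hN0
  have hN' : (0 : ℝ) < N := by positivity
  have hden : Real.sqrt 2 * Real.pi * N = Real.sqrt (2 * Real.pi ^ 2 * (N : ℝ) ^ 2) := by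
    rw [Real.sqrt_mul (by positivity), Real.sqrt_mul (by positivity), Real.sqrt_sq Real.pi_pos.le,
      Real.sqrt_sq hN'.le]
  simp only [Function.comp_apply, Pi.div_apply]
  rw [hden, ← Real.sqrt_div hN.le, ← Real.sqrt_div' _ (by positivity), expectedCost_eq hN0]
  congr 1
  field_simp
  ring

section HarmonicEnsemble

variable {Ω : Type*} [MeasurableSpace Ω] {T N : ℕ} {P : Measure Ω}
  {X : Ω → Finset UnitAddCircle}

theorem integral_bernoulliEnergy_eq [IsProbabilityMeasure P] (hN : N = 2 * T + 1)
    (h : IsHarmonicEnsemble T P X) :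
    ∫ ω, bernoulliEnergy (X ω) ∂P = 2 * (N : ℝ) ^ 2 * expectedCost N := by
  have hN' : (N : ℝ) ≠ 0 := by rw [hN]; positivity
  rw [(integral_bernoulliEnergy h).2, sum_sum_fourier_weights T N hN, ← hN, expectedCost]
  have hz := sum_add_tail_eq_zeta_two N
  generalize ∑' j : ℕ, 1 / ((N : ℝ) + 1 + (j : ℝ)) ^ 2 = t at *
  have ht : t = Real.pi ^ 2 / 6 - ∑ k ∈ Finset.Icc 1 N, 1 / (k : ℝ) ^ 2 := by linarith
  rw [ht]
  generalize ∑ k ∈ Finset.Icc 1 N, 1 / (k : ℝ) ^ 2 = s at *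
  generalize ∑ k ∈ Finset.Icc 1 N, 1 / (k : ℝ) = r
  have hpi := Real.pi_ne_zero
  field_simp
  ring

theorem harmonicEnsemble_wasserstein [IsProbabilityMeasure P] (hN : N = 2 * T + 1)
    (h : IsHarmonicEnsemble T P X) :
    Integrable (fun ω => wassersteinDist 2 (empiricalMeasure (X ω)) volume ^ 2) P ∧
      ∫ ω, wassersteinDist 2 (empiricalMeasure (X ω)) volume ^ 2 ∂P = expectedCost N := by
  have hN0 : N ≠ 0 := by omega
  have hN' : (N : ℝ) ≠ 0 := Nat.cast_ne_zero.mpr hN0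
  have hae : (fun ω => 1 / (2 * (N : ℝ) ^ 2) * bernoulliEnergy (X ω))
      =ᵐ[P] fun ω => wassersteinDist 2 (empiricalMeasure (X ω)) volume ^ 2 := by
    filter_upwards [card_harmonicEnsemble h] with ω hω
    rw [wassersteinDist_sq hN0 (hω.trans hN.symm)]
  refine ⟨((integral_bernoulliEnergy h).1.const_mul _).congr hae, ?_⟩
  rw [← integral_congr_ae hae, integral_const_mul, integral_bernoulliEnergy_eq hN h]
  field_simp

theorem harmonicEnsemble_discrepancy [IsProbabilityMeasure P] (hN : N = 2 * T + 1)
    (h : IsHarmonicEnsemble T P X) :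
    Integrable (fun ω => periodicDiscrepancy (X ω) ^ 2) P ∧
      ∫ ω, periodicDiscrepancy (X ω) ^ 2 ∂P = 2 * expectedCost N := by
  have hN0 : N ≠ 0 := by omega
  have hN' : (N : ℝ) ≠ 0 := Nat.cast_ne_zero.mpr hN0
  have hae : (fun ω => 1 / (N : ℝ) ^ 2 * bernoulliEnergy (X ω))
      =ᵐ[P] fun ω => periodicDiscrepancy (X ω) ^ 2 := by
    filter_upwards [card_harmonicEnsemble h] with ω hω
    rw [periodicDiscrepancy_sq hN0 (hω.trans hN.symm)]
  refine ⟨((integral_bernoulliEnergy h).1.const_mul _).congr hae, ?_⟩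
  rw [← integral_congr_ae hae, integral_const_mul, integral_bernoulliEnergy_eq hN h]
  field_simp

end HarmonicEnsemble

theorem theorem6 :
    -- the claims for each `T`, with `N = 2 T + 1` and an absolute constant `C`
    (∃ C : ℝ, ∀ (T N : ℕ), N = 2 * T + 1 →
      ∀ (Ω : Type*) [MeasurableSpace Ω] (P : Measure Ω) [IsProbabilityMeasure P]
        (X : Ω → Finset UnitAddCircle), IsHarmonicEnsemble T P X →
        (∀ᵐ ω ∂P, (X ω).card = N) ∧
        Integrable (fun ω => wassersteinDist 2 (empiricalMeasure (X ω)) volume ^ 2) P ∧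
        Integrable (fun ω => periodicDiscrepancy (X ω) ^ 2) P ∧
        ∫ ω, wassersteinDist 2 (empiricalMeasure (X ω)) volume ^ 2 ∂P
          = 1 / 2 * ∫ ω, periodicDiscrepancy (X ω) ^ 2 ∂P ∧
        ∫ ω, wassersteinDist 2 (empiricalMeasure (X ω)) volume ^ 2 ∂P
          = 1 / (2 * Real.pi ^ 2 * (N : ℝ) ^ 2) * ∑ k ∈ Finset.Icc 1 N, 1 / (k : ℝ)
            + 1 / (2 * Real.pi ^ 2 * (N : ℝ)) * ∑' j : ℕ, 1 / ((N : ℝ) + 1 + (j : ℝ)) ^ 2 ∧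
        |∫ ω, wassersteinDist 2 (empiricalMeasure (X ω)) volume ^ 2 ∂P
          - (Real.log N + Real.eulerMascheroniConstant + 1) / (2 * Real.pi ^ 2 * (N : ℝ) ^ 2)|
            ≤ C / (N : ℝ) ^ 3 ∧
        Real.sqrt (∫ ω, wassersteinDist 2 (empiricalMeasure (X ω)) volume ^ 2 ∂P)
          = 1 / Real.sqrt 2 * Real.sqrt (∫ ω, periodicDiscrepancy (X ω) ^ 2 ∂P)) ∧
    -- the asymptotic equivalence as `T → ∞`
    (∀ (Ω : ℕ → Type*) [∀ T, MeasurableSpace (Ω T)] (P : ∀ T, Measure (Ω T))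
        [∀ T, IsProbabilityMeasure (P T)] (X : ∀ T, Ω T → Finset UnitAddCircle),
      (∀ T, IsHarmonicEnsemble T (P T) (X T)) →
        Asymptotics.IsEquivalent atTop
          (fun T : ℕ => Real.sqrt
            (∫ ω, wassersteinDist 2 (empiricalMeasure (X T ω)) volume ^ 2 ∂(P T)))
          (fun T : ℕ => Real.sqrt (Real.log (2 * (T : ℝ) + 1))
            / (Real.sqrt 2 * Real.pi * (2 * (T : ℝ) + 1)))) := by
  refine ⟨⟨1, fun T N hN Ω _ P _ X h => ?_⟩, fun Ω _ P _ X h => ?_⟩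
  · have hN0 : N ≠ 0 := by omega
    obtain ⟨hWi, hW⟩ := harmonicEnsemble_wasserstein hN h
    obtain ⟨hDi, hD⟩ := harmonicEnsemble_discrepancy hN h
    refine ⟨hN ▸ card_harmonicEnsemble h, hWi, hDi, ?_, hW, ?_, ?_⟩
    · rw [hW, hD]
      ring
    · rw [hW]
      exact abs_expectedCost_sub_le hN0
    · rw [hW, hD, Real.sqrt_mul zero_le_two, ← mul_assoc,
        one_div_mul_cancel (Real.sqrt_ne_zero'.mpr two_pos), one_mul]
  · simp_rw [fun T => (harmonicEnsemble_wasserstein rfl (h T)).2]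
    have hT : Tendsto (fun T : ℕ => 2 * T + 1) atTop atTop :=
      tendsto_atTop_mono (fun T => (by omega : T ≤ 2 * T + 1)) tendsto_id
    have := isEquivalent_sqrt_expectedCost.comp_tendsto hT
    simpa [Function.comp_def] using this
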